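/- Let $1<p<\infty$, $p\neq 2$, and let $X=\ell_p$ be the space of $p$-summable sequences $(x_n)_{n\ge 0}$ of real scalars, or of complex scalars. Let $\mathcal B_1(X)=\{T\in\mathcal B(X):\|T\|\le 1\}$ be the closed unit ball of the space of bounded linear operators on $X$. Consider on $\mathcal B_1(X)$ the topologies in which a net $(T_i)$ converges to $T$ as follows: $\mathrm{SOT}$: $\|T_ix-Tx\|\to 0$ for all $x\in X$; $\mathrm{WOT}$: $T_ix\to Tx$ weakly for all $x\in X$; $\mathrm{SOT}_*$: $\|T_i^*x^*-T^*x^*\|\to 0$ for all $x^*\in X^*$, where $T^*$ denotes the Banach space adjoint; $\mathrm{SOT}^*$: both $T_i\to T$ in $\mathrm{SOT}$ and $T_i\to T$ in $\mathrm{SOT}_*$. Two topologies on the same set are called similar if they have the same dense sets, and $\mathcal C(\tau,\tau')$ denotes the set of points of continuity of the identity map from $(\mathcal B_1(X),\tau)$ to $(\mathcal B_1(X),\tau')$. (1) If $p>2$, then on $\mathcal B_1(X)$ the topologies $\mathrm{SOT}$ and $\mathrm{SOT}^*$ are similar, and the topologies $\mathrm{WOT}$ and $\mathrm{SOT}_*$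 are similar; moreover, $\mathcal C(\mathrm{WOT},\mathrm{SOT}_*)$ and $\mathcal C(\mathrm{SOT},\mathrm{SOT}^*)$ are $\mathrm{SOT}^*$-dense in $\mathcal B_1(X)$. (2) If $1<p<2$, then on $\mathcal B_1(X)$ the topologies $\mathrm{SOT}_*$ and $\mathrm{SOT}^*$ are similar, and the topologies $\mathrm{WOT}$ and $\mathrm{SOT}$ are similar; moreover, $\mathcal C(\mathrm{WOT},\mathrm{SOT})$ and $\mathcal C(\mathrm{SOT}_*,\mathrm{SOT}^*)$ are $\mathrm{SOT}^*$-dense in $\mathcal B_1(X)$. -/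

import Mathlib

open Topology
open scoped ENNReal

/-- Two topologies on the same set are similar if they have the same dense sets. -/
def SimilarTopologies {M : Type*} (τ τ' : TopologicalSpace M) : Prop :=
  ∀ D : Set M, @Dense M τ D ↔ @Dense M τ' D

/-- The set `C(τ, τ')` of points of continuity of the identity map `(M, τ) → (M, τ')`. -/
def continuityPoints {M : Type*} (τ τ' : TopologicalSpace M) : Set M :=
  {x | @ContinuousAt M M τ τ' id x}

/-- The closed unit ball of the space of bounded operators on `X`, i.e. the set of contractions. -/
abbrev OpBall (𝕜 X : Type*) [RCLike 𝕜] [NormedAddCommGroup X] [NormedSpace 𝕜 X] : Type _ :=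
  {T : X →L[𝕜] X // ‖T‖ ≤ 1}

namespace OpTopology

section

variable (𝕜 X : Type*) [RCLike 𝕜] [NormedAddCommGroup X] [NormedSpace 𝕜 X]

/-- The strong operator topology on `B(X)`: pointwise convergence in norm. -/
@[reducible] noncomputable def strong : TopologicalSpace (X →L[𝕜] X) :=
  TopologicalSpace.induced (ContinuousLinearMap.toPointwiseConvergenceCLM 𝕜 (RingHom.id 𝕜) X X)
    inferInstance

/-- The weak operator topology on `B(X)`: pointwise convergence in the weak topology. -/
@[reducible] noncomputable def weak : TopologicalSpace (X →L[𝕜] X) :=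
  TopologicalSpace.induced (fun T => (ContinuousLinearMapWOT.ofCLM T : X →WOT[𝕜] X)) inferInstance

/-- The dual strong operator topology on `B(X)`: strong convergence of the Banach space adjoints
`T* : X* → X*`, `T* f = f ∘ T`. -/
@[reducible] noncomputable def dualStrong : TopologicalSpace (X →L[𝕜] X) :=
  TopologicalSpace.induced
    (fun T : X →L[𝕜] X => (T.precomp 𝕜 : StrongDual 𝕜 X →L[𝕜] StrongDual 𝕜 X))
    (strong 𝕜 (StrongDual 𝕜 X))

/-- The strong* operator topology on `B(X)`: strong convergence of the operators and of their
adjoints, i.e. the coarsest topology finer than both (Mathlib orders topologies so that finer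
is smaller, so this is an infimum). -/
@[reducible] noncomputable def strongStar : TopologicalSpace (X →L[𝕜] X) :=
  strong 𝕜 X ⊓ dualStrong 𝕜 X

/-- The topology `SOT` on the unit ball of `B(X)`. -/
@[reducible] noncomputable def SOT : TopologicalSpace (OpBall 𝕜 X) :=
  TopologicalSpace.induced Subtype.val (strong 𝕜 X)

/-- The topology `WOT` on the unit ball of `B(X)`. -/
@[reducible] noncomputable def WOT : TopologicalSpace (OpBall 𝕜 X) :=
  TopologicalSpace.induced Subtype.val (weak 𝕜 X)

/-- The topology `SOT_*` on the unit ball of `B(X)`. -/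
@[reducible] noncomputable def SOTLowerStar : TopologicalSpace (OpBall 𝕜 X) :=
  TopologicalSpace.induced Subtype.val (dualStrong 𝕜 X)

/-- The topology `SOT^*` on the unit ball of `B(X)`. -/
@[reducible] noncomputable def SOTStar : TopologicalSpace (OpBall 𝕜 X) :=
  TopologicalSpace.induced Subtype.val (strongStar 𝕜 X)

end

end OpTopology

/-- The space `ℓ_p` of `p`-summable sequences of scalars. -/
abbrev SeqLp (𝕜 : Type*) [RCLike 𝕜] (p : ℝ≥0∞) : Type _ :=
  lp (fun _ : ℕ => 𝕜) p

/-!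
All four density statements reduce to one: the set `C(WOT, SOT)` for `p < 2`, and the set
`C(WOT, SOT_*)` for `p > 2`, is dense for `SOT^*`. Indeed a set that is dense for a topology `τ` has
every point of `C(τ, τ')` in its `τ'`-closure, and `C(τ, τ') ⊆ C(σ, σ ⊓ τ')` when `σ` is finer
than `τ`.

*Points of continuity.* Let contractions `S` tend to `T` in `WOT`.

* Let `p < 2`, `‖T y‖ = ‖y‖` and `y n ≠ 0`. Put `w± = y ± s y_n e_n` and let `h±` be the weakly null
  vectors `S w± - T w±`. Asymptotically `‖S w±‖ ^ p` is `‖T w±‖ ^ p + ‖h±‖ ^ p`, it is at most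
  `‖w±‖ ^ p`, and `‖T w₊‖ ^ p + ‖T w₋‖ ^ p ≥ 2 ‖y‖ ^ p` by convexity, so
  `‖h₊‖ ^ p + ‖h₋‖ ^ p = O(s²)`. As `h₊ - h₋ = 2 s y_n (S e_n - T e_n)` and `p < 2`, letting `s`
  tend to zero shows that `S e_n` tends to `T e_n` in norm
  (`tendsto_apply_single_of_norming`). If there is such a `y` for each `n`, then `T ∈ C(WOT, SOT)`.
* Let `p > 2`, `‖T y‖ = ‖y‖` and `(T y)_n ≠ 0`. For a unit vector `u` supported far away,
  `‖y ± t u‖ ^ p = ‖y‖ ^ p + t ^ p`, while `‖S y + t S u‖ ^ p + ‖S y - t S u‖ ^ p` exceeds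
  `2 ‖S y‖ ^ p` by at least a constant times `t² |(S u)_n|²`. So the `n`-th row of `S` has uniformly
  small tails (`eventually_norm_apply_le_of_norming`) and `S* e_n*` tends to `T* e_n*` in norm. If
  there is such a `y` for each `n`, then `T ∈ C(WOT, SOT_*)`.

*Density.* A contraction is the `SOT^*`-limit of its compressions to the first `N` coordinates,
completed by the identity. On the first `N + 1` coordinates such an operator is a matrix `A` of
norm one. A rank one perturbation changing only the `n`-th column (row) can increase `‖A‖` strictly
above the norm of the matrix in which this column (row) is deleted (`exists_near_norm_comp_lt`,
`exists_near_norm_coordRestrict_comp_lt`). This is an open condition, so it can be achieved for all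
`n` simultaneously. Any vector at which the new matrix attains its norm then has a nonzero `n`-th
coordinate (an image with a nonzero `n`-th coordinate) for every `n`; such a vector exists by
compactness, and basis vectors do for the coordinates on which the operator is the identity.
-/

open Filter

/-! ### Coordinate restrictions and finite-dimensional approximation -/

section CoordRestrict

variable {𝕜 : Type*} [RCLike 𝕜] {p : ℝ≥0∞} [Fact (1 ≤ p)]

/-- The contraction of `ℓ_p` that keeps the coordinates in `s` and replaces the others by zero. -/
noncomputable def coordRestrict (s : Set ℕ) : SeqLp 𝕜 p →L[𝕜] SeqLp 𝕜 p :=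
  LinearMap.mkContinuous
    { toFun := fun x => ⟨s.indicator (x : ℕ → 𝕜),
        (lp.memℓp x).mono' fun i => norm_indicator_le_norm_self _ _⟩
      map_add' := fun x y => lp.ext (Set.indicator_add s _ _)
      map_smul' := fun c x => lp.ext (Set.indicator_const_smul s c (x : ℕ → 𝕜)) }
    1 fun x => by
      rw [one_mul]
      exact lp.norm_mono (zero_lt_one.trans_le Fact.out).ne'
        fun i => norm_indicator_le_norm_self _ _

theorem coordRestrict_apply (s : Set ℕ) (x : SeqLp 𝕜 p) (k : ℕ) :
    coordRestrict s x k = s.indicator (x : ℕ → 𝕜) k := rfl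

theorem coordRestrict_apply_of_mem {s : Set ℕ} {k : ℕ} (h : k ∈ s) (x : SeqLp 𝕜 p) :
    coordRestrict s x k = x k := by
  rw [coordRestrict_apply, Set.indicator_of_mem h]

theorem coordRestrict_apply_of_notMem {s : Set ℕ} {k : ℕ} (h : k ∉ s) (x : SeqLp 𝕜 p) :
    coordRestrict s x k = 0 := by
  rw [coordRestrict_apply, Set.indicator_of_notMem h]

theorem norm_coordRestrict_apply_le (s : Set ℕ) (x : SeqLp 𝕜 p) : ‖coordRestrict s x‖ ≤ ‖x‖ :=
  lp.norm_mono (zero_lt_one.trans_le Fact.out).ne' fun _ => norm_indicator_le_norm_self _ _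

theorem norm_coordRestrict_le (s : Set ℕ) :
    ‖(coordRestrict s : SeqLp 𝕜 p →L[𝕜] SeqLp 𝕜 p)‖ ≤ 1 :=
  ContinuousLinearMap.opNorm_le_bound _ zero_le_one fun x => by
    rw [one_mul]
    exact norm_coordRestrict_apply_le s x

theorem coordRestrict_coordRestrict (s t : Set ℕ) (x : SeqLp 𝕜 p) :
    coordRestrict s (coordRestrict t x) = coordRestrict (s ∩ t) x :=
  lp.ext (Set.indicator_indicator s t (x : ℕ → 𝕜))

theorem coordRestrict_idem (s : Set ℕ) (x : SeqLp 𝕜 p) :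
    coordRestrict s (coordRestrict s x) = coordRestrict s x := by
  rw [coordRestrict_coordRestrict, Set.inter_self]

theorem coordRestrict_add_compl (s : Set ℕ) (x : SeqLp 𝕜 p) :
    coordRestrict s x + coordRestrict sᶜ x = x :=
  lp.ext (Set.indicator_self_add_compl s _)

theorem coordRestrict_eq_self_iff {s : Set ℕ} {x : SeqLp 𝕜 p} :
    coordRestrict s x = x ↔ ∀ k ∉ s, x k = 0 := by
  refine ⟨fun h k hk => ?_, fun h => lp.ext (funext fun k => ?_)⟩
  · rw [← h, coordRestrict_apply_of_notMem hk]
  · by_cases hk : k ∈ s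
    · exact coordRestrict_apply_of_mem hk x
    · rw [coordRestrict_apply_of_notMem hk, h k hk]

theorem coordRestrict_eq_zero_iff {s : Set ℕ} {x : SeqLp 𝕜 p} :
    coordRestrict s x = 0 ↔ ∀ k ∈ s, x k = 0 := by
  refine ⟨fun h k hk => ?_, fun h => lp.ext (funext fun k => ?_)⟩
  · rw [← coordRestrict_apply_of_mem hk x, h]; rfl
  · by_cases hk : k ∈ s
    · rw [coordRestrict_apply_of_mem hk, h k hk]; rfl
    · rw [coordRestrict_apply_of_notMem hk]; rfl

theorem coordRestrict_mono {s t : Set ℕ} (hst : s ⊆ t) {x : SeqLp 𝕜 p}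
    (hx : coordRestrict s x = x) : coordRestrict t x = x :=
  coordRestrict_eq_self_iff.2 fun k hk => coordRestrict_eq_self_iff.1 hx k fun h => hk (hst h)

theorem coordRestrict_eq_zero_of_disjoint {s t : Set ℕ} (hst : Disjoint s t) {x : SeqLp 𝕜 p}
    (hx : coordRestrict t x = x) : coordRestrict s x = 0 :=
  coordRestrict_eq_zero_iff.2 fun k hk =>
    coordRestrict_eq_self_iff.1 hx k (Set.disjoint_left.1 hst hk)

theorem coordRestrict_single_of_mem {s : Set ℕ} {n : ℕ} (hn : n ∈ s) (a : 𝕜) :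
    coordRestrict s (lp.single p n a : SeqLp 𝕜 p) = lp.single p n a :=
  coordRestrict_eq_self_iff.2 fun k hk =>
    lp.single_apply_ne (E := fun _ : ℕ => 𝕜) p n a fun h : k = n => hk (h.symm ▸ hn)

theorem coordRestrict_single_of_notMem {s : Set ℕ} {n : ℕ} (hn : n ∉ s) (a : 𝕜) :
    coordRestrict s (lp.single p n a : SeqLp 𝕜 p) = 0 :=
  coordRestrict_eq_zero_iff.2 fun k hk =>
    lp.single_apply_ne (E := fun _ : ℕ => 𝕜) p n a fun h : k = n => hn (h ▸ hk)

theorem norm_rpow_eq_coordRestrict (hp : 0 < p.toReal) (s : Set ℕ) (x : SeqLp 𝕜 p) :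
    ‖x‖ ^ p.toReal = ‖coordRestrict s x‖ ^ p.toReal + ‖coordRestrict sᶜ x‖ ^ p.toReal := by
  refine (lp.hasSum_norm hp x).unique
    (((lp.hasSum_norm hp (coordRestrict s x)).add
      (lp.hasSum_norm hp (coordRestrict sᶜ x))).congr_fun fun k => ?_)
  by_cases hk : k ∈ s
  · rw [coordRestrict_apply_of_mem hk, coordRestrict_apply_of_notMem (by simpa using hk),
      norm_zero, Real.zero_rpow hp.ne', add_zero]
  · rw [coordRestrict_apply_of_notMem hk, coordRestrict_apply_of_mem (by simpa using hk),
      norm_zero, Real.zero_rpow hp.ne', zero_add]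

theorem norm_rpow_add_of_coordRestrict (hp : 0 < p.toReal) {s : Set ℕ} {x y : SeqLp 𝕜 p}
    (hx : coordRestrict s x = x) (hy : coordRestrict s y = 0) :
    ‖x + y‖ ^ p.toReal = ‖x‖ ^ p.toReal + ‖y‖ ^ p.toReal := by
  have h1 := coordRestrict_add_compl s x
  have h2 := coordRestrict_add_compl s y
  rw [hx, add_eq_left] at h1
  rw [hy, zero_add] at h2
  rw [norm_rpow_eq_coordRestrict hp s, map_add, map_add, hx, hy, h1, h2, add_zero, zero_add]

theorem coordRestrict_singleton (n : ℕ) (x : SeqLp 𝕜 p) :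
    coordRestrict {n} x = lp.single p n (x n) := by
  refine lp.ext (funext fun k => ?_)
  by_cases hk : k = n
  · subst hk
    rw [coordRestrict_apply_of_mem (Set.mem_singleton k), lp.single_apply_self]
  · rw [coordRestrict_apply_of_notMem (by simpa using hk), lp.single_apply_ne p n _ hk]

theorem norm_rpow_eq_compl_singleton (hp : 0 < p.toReal) (n : ℕ) (x : SeqLp 𝕜 p) :
    ‖x‖ ^ p.toReal = ‖x n‖ ^ p.toReal + ‖coordRestrict {n}ᶜ x‖ ^ p.toReal := by
  rw [norm_rpow_eq_coordRestrict hp {n}, coordRestrict_singleton,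
    lp.norm_single (zero_lt_one.trans_le Fact.out)]

theorem coordRestrict_Iio (N : ℕ) (x : SeqLp 𝕜 p) :
    coordRestrict (Set.Iio N) x = ∑ k ∈ Finset.range N, lp.single p k (x k) := by
  refine lp.ext (funext fun k => ?_)
  rw [lp.coeFn_sum, Finset.sum_apply]
  simp only [lp.coeFn_single, Finset.sum_pi_single, Finset.mem_range]
  split_ifs with hk
  · exact coordRestrict_apply_of_mem (s := Set.Iio N) hk x
  · exact coordRestrict_apply_of_notMem (s := Set.Iio N) hk x

theorem tendsto_coordRestrict_Iio (hp : p ≠ ⊤) (x : SeqLp 𝕜 p) :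
    Tendsto (fun N => coordRestrict (Set.Iio N) x) atTop (𝓝 x) := by
  simp only [coordRestrict_Iio]
  exact (lp.hasSum_single hp x).tendsto_sum_nat

theorem tendsto_coordRestrict_Iio_of_coord {ι : Type*} {l : Filter ι} {g : ι → SeqLp 𝕜 p}
    {v : SeqLp 𝕜 p} (h : ∀ k, Tendsto (fun i => g i k) l (𝓝 (v k))) (N : ℕ) :
    Tendsto (fun i => coordRestrict (Set.Iio N) (g i)) l (𝓝 (coordRestrict (Set.Iio N) v)) := by
  simp only [coordRestrict_Iio]
  exact tendsto_finsetSum _ fun k _ =>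
    ((lp.isometry_single (E := fun _ : ℕ => 𝕜) (p := p) k).continuous.tendsto _).comp (h k)

theorem le_one_add_of_rpow_le {a s r : ℝ} (hr : 1 ≤ r) (hs : 0 ≤ s)
    (h : a ^ r ≤ 1 + s) : a ≤ 1 + s := by
  rcases le_total a 1 with h1 | h1
  · linarith
  · exact (Real.self_le_rpow_of_one_le h1 hr).trans h

/-- A unimodular scalar can be chosen to align two given scalars. -/
theorem exists_norm_eq_one_norm_add_mul (a b : 𝕜) :
    ∃ c : 𝕜, ‖c‖ = 1 ∧ ‖a + c * b‖ = ‖a‖ + ‖b‖ := by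
  by_cases ha : a = 0
  · exact ⟨1, by simp, by simp [ha]⟩
  by_cases hb : b = 0
  · exact ⟨1, by simp, by simp [hb]⟩
  have ha' : ‖a‖ ≠ 0 := norm_ne_zero_iff.2 ha
  have hb' : ‖b‖ ≠ 0 := norm_ne_zero_iff.2 hb
  have ha2 : (‖a‖ : 𝕜) ≠ 0 := by exact_mod_cast ha'
  refine ⟨a / ‖a‖ * (‖b‖ / b), by simp [ha', hb'], ?_⟩
  have : a + a / ‖a‖ * (‖b‖ / b) * b = a / ‖a‖ * ((‖a‖ + ‖b‖ : ℝ) : 𝕜) := by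
    push_cast
    field_simp
  rw [this, norm_mul, RCLike.norm_ofReal, abs_of_nonneg (by positivity)]
  simp [ha']

/-- For `p > 1` the tails of a functional on `ℓ_p` are small: if `y` almost norms `f` and has
finite support, then `f (y + t u)` with `u` supported far away has no room to exceed `f y` by more
than the order `t ^ p`. -/
theorem tendsto_norm_comp_coordRestrict_compl (hp : 1 < p.toReal) (hp_top : p ≠ ⊤)
    (f : StrongDual 𝕜 (SeqLp 𝕜 p)) :
    Tendsto (fun N => ‖f.comp (coordRestrict (Set.Iio N)ᶜ)‖) atTop (𝓝 0) := by
  have hp0 : 0 < p.toReal := zero_lt_one.trans hp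
  rw [Metric.tendsto_nhds]
  intro ε hε
  obtain ⟨τ, hτ, hτε⟩ : ∃ τ : ℝ, 0 < τ ∧ ‖f‖ * τ ^ (p.toReal - 1) < ε / 4 := by
    have h : Tendsto (fun τ : ℝ => ‖f‖ * τ ^ (p.toReal - 1)) (𝓝[>] 0) (𝓝 (‖f‖ * 0)) := by
      refine Tendsto.const_mul _ (tendsto_nhdsWithin_of_tendsto_nhds ?_)
      have := (Real.continuousAt_rpow_const 0 (p.toReal - 1) (Or.inr (by linarith))).tendsto
      rwa [Real.zero_rpow (by linarith)] at this
    rw [mul_zero] at h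
    obtain ⟨τ, h1, h2⟩ := ((h.eventually_lt_const (by positivity : 0 < ε / 4)).and
      self_mem_nhdsWithin).exists
    exact ⟨τ, h2, h1⟩
  obtain ⟨y, hy1, hy⟩ : ∃ y, ‖y‖ ≤ 1 ∧ ‖f‖ - ε / 4 * τ < ‖f y‖ := by
    rcases lt_or_ge (‖f‖ - ε / 4 * τ) 0 with h | h
    · exact ⟨0, by simp, by simpa using h⟩
    · lift ‖f‖ - ε / 4 * τ to NNReal using h with a ha
      obtain ⟨y, h1, h2⟩ := f.exists_lt_apply_of_lt_opNorm (r := a)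
        (by rw [ha]; linarith [mul_pos (by positivity : 0 < ε / 4) hτ])
      exact ⟨y, h1.le, h2⟩
  have hlim : Tendsto (fun N => ‖f (coordRestrict (Set.Iio N) y)‖) atTop (𝓝 ‖f y‖) :=
    ((f.continuous.tendsto _).comp (tendsto_coordRestrict_Iio hp_top y)).norm
  filter_upwards [hlim.eventually_const_lt hy] with N hN
  rw [dist_zero_right, norm_norm]
  refine lt_of_le_of_lt (ContinuousLinearMap.opNorm_le_bound _ (by positivity : 0 ≤ ε / 2)
    fun u => ?_) (by linarith)
  rcases eq_or_ne u 0 with rfl | hu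
  · simp
  have hu' : 0 < ‖u‖ := norm_pos_iff.2 hu
  set v := coordRestrict (Set.Iio N)ᶜ u with hv
  have hvu : ‖v‖ ≤ ‖u‖ := norm_coordRestrict_apply_le _ _
  have hv0 : coordRestrict (Set.Iio N) v = 0 := by
    rw [hv, coordRestrict_coordRestrict, Set.inter_compl_self]
    exact coordRestrict_eq_zero_iff.2 fun k hk => hk.elim
  obtain ⟨c, hc, hcf⟩ := exists_norm_eq_one_norm_add_mul (f (coordRestrict (Set.Iio N) y))
    (((τ / ‖u‖ : ℝ) : 𝕜) * f v)
  have hw : ‖coordRestrict (Set.Iio N) y + (c * ((τ / ‖u‖ : ℝ) : 𝕜)) • v‖ ≤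
      1 + τ ^ p.toReal := by
    refine le_one_add_of_rpow_le hp.le (by positivity) ?_
    rw [norm_rpow_add_of_coordRestrict hp0 (coordRestrict_idem _ _)
      (by rw [map_smul, hv0, smul_zero])]
    refine add_le_add (Real.rpow_le_one (norm_nonneg _)
      ((norm_coordRestrict_apply_le _ _).trans hy1) hp0.le)
      (Real.rpow_le_rpow (norm_nonneg _) ?_ hp0.le)
    rw [norm_smul, norm_mul, hc, RCLike.norm_ofReal, abs_of_pos (by positivity), one_mul]
    calc τ / ‖u‖ * ‖v‖ ≤ τ / ‖u‖ * ‖u‖ := by gcongr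
      _ = τ := by field_simp
  have h1 := f.le_opNorm_of_le hw
  rw [map_add, map_smul, smul_eq_mul, mul_assoc, hcf, norm_mul, RCLike.norm_ofReal,
    abs_of_pos (by positivity)] at h1
  have h2 : τ ^ p.toReal = τ * τ ^ (p.toReal - 1) := by
    rw [Real.rpow_sub_one hτ.ne']; field_simp
  have h3 : τ * (‖f v‖ / ‖u‖) ≤ τ * (ε / 2) := by
    have : τ / ‖u‖ * ‖f v‖ = τ * (‖f v‖ / ‖u‖) := by ring
    rw [h2] at h1
    nlinarith [mul_lt_mul_of_pos_left hτε hτ]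
  have h4 := le_of_mul_le_mul_left h3 hτ
  rwa [div_le_iff₀ hu'] at h4

/-- An operator depending on finitely many coordinates only attains its norm, by compactness. -/
theorem exists_norm_apply_eq (N : ℕ) (B : SeqLp 𝕜 p →L[𝕜] SeqLp 𝕜 p)
    (hB : ∀ x, B (coordRestrict (Set.Iio N) x) = B x) :
    ∃ x, ‖x‖ ≤ 1 ∧ coordRestrict (Set.Iio N) x = x ∧ ‖B x‖ = ‖B‖ := by
  set K : Set (SeqLp 𝕜 p) := {x | ‖x‖ ≤ 1 ∧ coordRestrict (Set.Iio N) x = x} with hK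
  have hKc : IsCompact K := by
    have hcont : Continuous fun c : ℕ → 𝕜 =>
        ∑ k ∈ Finset.range N, (lp.single p k (c k) : SeqLp 𝕜 p) :=
      continuous_finsetSum _ fun k _ =>
        (lp.isometry_single (E := fun _ : ℕ => 𝕜) (p := p) k).continuous.comp
          (continuous_apply k)
    refine ((isCompact_univ_pi fun _ : ℕ => isCompact_closedBall (0 : 𝕜) 1).image
      hcont).of_isClosed_subset ?_ ?_
    · exact (isClosed_le continuous_norm continuous_const).inter
        (isClosed_eq (coordRestrict (Set.Iio N)).continuous continuous_id)
    · rintro x ⟨hx1, hx2⟩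
      refine ⟨x, fun k _ => ?_, ?_⟩
      · rw [mem_closedBall_zero_iff]
        exact (lp.norm_apply_le_norm (zero_lt_one.trans_le Fact.out).ne' x k).trans hx1
      · exact (coordRestrict_Iio N x).symm.trans hx2
  obtain ⟨x, ⟨hx1, hx2⟩, hx⟩ := hKc.exists_isMaxOn ⟨0, by simp [hK]⟩
    (B.continuous.norm.continuousOn)
  refine ⟨x, hx1, hx2, le_antisymm (B.unit_le_opNorm x hx1) ?_⟩
  by_contra! h
  obtain ⟨z, hz1, hz⟩ := B.exists_lt_apply_of_lt_opNorm (r := ‖B x‖₊) h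
  have := hx (show coordRestrict (Set.Iio N) z ∈ K from
    ⟨(norm_coordRestrict_apply_le _ _).trans hz1.le, coordRestrict_idem _ _⟩)
  simp only [Set.mem_ofPred_eq, hB] at this
  exact absurd hz (not_lt.2 this)

end CoordRestrict

/-! ### Convergence in the operator topologies -/

section Topologies

variable {𝕜 X : Type*} [RCLike 𝕜] [NormedAddCommGroup X] [NormedSpace 𝕜 X]
  {ι : Type*} {l : Filter ι} {g : ι → OpBall 𝕜 X} {T : OpBall 𝕜 X}

theorem tendsto_nhds_strong {Y : Type*} [NormedAddCommGroup Y] [NormedSpace 𝕜 Y]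
    {h : ι → Y →L[𝕜] Y} {S : Y →L[𝕜] Y} :
    Tendsto h l (@nhds _ (OpTopology.strong 𝕜 Y) S) ↔
      ∀ x, Tendsto (fun i => h i x) l (𝓝 (S x)) := by
  rw [nhds_induced, tendsto_comap_iff, PointwiseConvergenceCLM.tendsto_iff_forall_tendsto]
  rfl

theorem tendsto_nhds_SOT :
    Tendsto g l (@nhds _ (OpTopology.SOT 𝕜 X) T) ↔
      ∀ x, Tendsto (fun i => (g i).1 x) l (𝓝 (T.1 x)) := by
  rw [@nhds_induced _ _ (OpTopology.strong 𝕜 X), tendsto_comap_iff]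
  exact tendsto_nhds_strong

theorem tendsto_nhds_SOTLowerStar :
    Tendsto g l (@nhds _ (OpTopology.SOTLowerStar 𝕜 X) T) ↔
      ∀ f : StrongDual 𝕜 X, Tendsto (fun i => f.comp (g i).1) l (𝓝 (f.comp T.1)) := by
  rw [@nhds_induced _ _ (OpTopology.dualStrong 𝕜 X), tendsto_comap_iff,
    @nhds_induced _ _ (OpTopology.strong 𝕜 (StrongDual 𝕜 X)), tendsto_comap_iff]
  exact tendsto_nhds_strong

theorem tendsto_nhds_WOT :
    Tendsto g l (@nhds _ (OpTopology.WOT 𝕜 X) T) ↔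
      ∀ (x : X) (f : StrongDual 𝕜 X), Tendsto (fun i => f ((g i).1 x)) l (𝓝 (f (T.1 x))) := by
  rw [@nhds_induced _ _ (OpTopology.weak 𝕜 X), tendsto_comap_iff, nhds_induced, tendsto_comap_iff,
    ContinuousLinearMapWOT.tendsto_iff_forall_dual_apply_tendsto]
  rfl

theorem SOTStar_eq_inf :
    OpTopology.SOTStar 𝕜 X = OpTopology.SOT 𝕜 X ⊓ OpTopology.SOTLowerStar 𝕜 X :=
  induced_inf

theorem tendsto_nhds_SOTStar :
    Tendsto g l (@nhds _ (OpTopology.SOTStar 𝕜 X) T) ↔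
      Tendsto g l (@nhds _ (OpTopology.SOT 𝕜 X) T) ∧
        Tendsto g l (@nhds _ (OpTopology.SOTLowerStar 𝕜 X) T) := by
  rw [SOTStar_eq_inf, @nhds_inf _ (OpTopology.SOT 𝕜 X) (OpTopology.SOTLowerStar 𝕜 X), tendsto_inf]

theorem SOT_le_WOT : OpTopology.SOT 𝕜 X ≤ OpTopology.WOT 𝕜 X :=
  le_of_nhds_le_nhds fun T => by
    have h := tendsto_nhds_SOT.1 (tendsto_id (x := @nhds _ (OpTopology.SOT 𝕜 X) T))
    exact tendsto_nhds_WOT.2 fun x f => (f.continuous.tendsto _).comp (h x)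

theorem SOTLowerStar_le_WOT : OpTopology.SOTLowerStar 𝕜 X ≤ OpTopology.WOT 𝕜 X :=
  le_of_nhds_le_nhds fun T => by
    have h := tendsto_nhds_SOTLowerStar.1
      (tendsto_id (x := @nhds _ (OpTopology.SOTLowerStar 𝕜 X) T))
    exact tendsto_nhds_WOT.2 fun x f =>
      ((ContinuousLinearMap.apply 𝕜 𝕜 x).continuous.tendsto _).comp (h f)

theorem SOTStar_le_SOT : OpTopology.SOTStar 𝕜 X ≤ OpTopology.SOT 𝕜 X :=
  SOTStar_eq_inf.trans_le inf_le_left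

theorem SOTStar_le_SOTLowerStar : OpTopology.SOTStar 𝕜 X ≤ OpTopology.SOTLowerStar 𝕜 X :=
  SOTStar_eq_inf.trans_le inf_le_right

end Topologies

/-! ### Similar topologies and points of continuity -/

section Similar

variable {M : Type*} {τ τ' σ : TopologicalSpace M}

theorem Dense.of_le (h : τ' ≤ τ) {D : Set M} (hD : @Dense M τ' D) : @Dense M τ D := by
  intro x
  rw [@mem_closure_iff_clusterPt M τ]
  exact NeBot.mono ((@mem_closure_iff_clusterPt M τ' x D).1 (hD x))
    (inf_le_inf_right _ (nhds_mono h))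

/-- A finer topology with densely many points of continuity of `(M, τ) → (M, τ')` has no fewer
dense sets: a `τ`-dense set has each point of continuity in its `τ'`-closure. -/
theorem SimilarTopologies.of_dense_continuityPoints (h : τ' ≤ τ)
    (hd : @Dense M τ' (continuityPoints τ τ')) : SimilarTopologies τ τ' := by
  refine fun D => ⟨fun hD => ?_, Dense.of_le h⟩
  have hsub : continuityPoints τ τ' ⊆ @closure M τ' D := fun x hx => by
    have hx' : Tendsto id (@nhds M τ x) (@nhds M τ' x) := hx
    have := (@mem_closure_iff_clusterPt M τ x D).1 (hD x)
    exact (@mem_closure_iff_clusterPt M τ' x D).2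
      (NeBot.mono this (inf_le_inf_right _ hx'))
  intro x
  have := Set.mem_of_subset_of_mem (@closure_mono M τ' _ _ hsub) (hd x)
  rwa [@closure_closure M τ'] at this

/-- At a point of `C(τ, τ')`, a topology `σ` finer than `τ` is locally finer than `τ'` too. -/
theorem continuityPoints_subset_inf (h : σ ≤ τ) :
    continuityPoints τ τ' ⊆ continuityPoints σ (σ ⊓ τ') := fun x hx => by
  have hx' : Tendsto id (@nhds M τ x) (@nhds M τ' x) := hx
  change Tendsto id (@nhds M σ x) (@nhds M (σ ⊓ τ') x)
  rw [nhds_inf]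
  exact tendsto_inf.2 ⟨tendsto_id, hx'.mono_left (nhds_mono h)⟩

end Similar

/-! ### Points of continuity from norm-attaining vectors -/

section Criteria

/-- Contractions converge strongly at a limit of vectors at which they converge strongly. -/
theorem tendsto_apply_of_tendsto_seq {𝕜 E F ι : Type*} [RCLike 𝕜] [NormedAddCommGroup E]
    [NormedSpace 𝕜 E] [NormedAddCommGroup F] [NormedSpace 𝕜 F] {l : Filter ι}
    {S : ι → E →L[𝕜] F} {T : E →L[𝕜] F} (hS : ∀ i, ‖S i‖ ≤ 1) (hT : ‖T‖ ≤ 1) {u : ℕ → E} {x : E}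
    (hu : Tendsto u atTop (𝓝 x)) (h : ∀ N, Tendsto (fun i => S i (u N)) l (𝓝 (T (u N)))) :
    Tendsto (fun i => S i x) l (𝓝 (T x)) := by
  rw [Metric.tendsto_nhds]
  intro ε hε
  obtain ⟨N, hN⟩ := (Metric.tendsto_nhds.1 hu (ε / 3) (by positivity)).exists
  filter_upwards [Metric.tendsto_nhds.1 (h N) (ε / 3) (by positivity)] with i hi
  have h1 : dist (S i x) (S i (u N)) ≤ dist (u N) x := by
    rw [dist_comm, dist_eq_norm, dist_eq_norm, ← map_sub]
    simpa using (S i).le_of_opNorm_le (hS i) (u N - x)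
  have h2 : dist (T (u N)) (T x) ≤ dist (u N) x := by
    rw [dist_eq_norm, dist_eq_norm, ← map_sub]
    simpa using T.le_of_opNorm_le hT (u N - x)
  linarith [dist_triangle4 (S i x) (S i (u N)) (T (u N)) (T x)]

theorem two_mul_norm_rpow_le {E : Type*} [NormedAddCommGroup E] [NormedSpace ℝ E] {r : ℝ}
    (hr : 1 ≤ r) (x y : E) : 2 * ‖x‖ ^ r ≤ ‖x + y‖ ^ r + ‖x - y‖ ^ r := by
  have h1 : ‖x‖ ≤ (1 / 2 : ℝ) * ‖x + y‖ + (1 / 2 : ℝ) * ‖x - y‖ := by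
    have h : (2 : ℝ) • x = (x + y) + (x - y) := by rw [two_smul]; abel
    have h' := norm_add_le (x + y) (x - y)
    rw [← h, norm_smul, Real.norm_two] at h'
    linarith
  have h2 := (convexOn_rpow hr).2 (norm_nonneg (x + y)) (norm_nonneg (x - y))
    (by norm_num : (0 : ℝ) ≤ 1 / 2) (by norm_num : (0 : ℝ) ≤ 1 / 2) (by norm_num)
  have h3 := Real.rpow_le_rpow (norm_nonneg x) h1 (zero_le_one.trans hr)
  simp only [smul_eq_mul] at h2
  linarith

/-- For `r ≤ 2` the mean of `(1 ± s) ^ r` is at most `(1 + s²) ^ (r / 2)`, by concavity of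
`x ↦ x ^ (r / 2)`. -/
theorem one_add_rpow_add_one_sub_rpow_le {r s : ℝ} (hr : 0 ≤ r) (hr2 : r ≤ 2) (hs : 0 ≤ s)
    (hs1 : s ≤ 1) : (1 + s) ^ r + (1 - s) ^ r ≤ 2 * (1 + s ^ 2) := by
  have h0 : ∀ a : ℝ, 0 ≤ a → a ^ r = (a ^ 2) ^ (r / 2) := fun a ha => by
    rw [← Real.rpow_natCast, ← Real.rpow_mul ha]
    congr 1
    push_cast
    ring
  have h1 := (Real.concaveOn_rpow (p := r / 2) (by linarith) (by linarith)).2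
    (sq_nonneg (1 + s)) (sq_nonneg (1 - s))
    (by norm_num : (0 : ℝ) ≤ 1 / 2) (by norm_num : (0 : ℝ) ≤ 1 / 2) (by norm_num)
  simp only [smul_eq_mul] at h1
  rw [h0 _ (by linarith), h0 _ (by linarith)]
  have h2 : (1 / 2 * (1 + s) ^ 2 + 1 / 2 * (1 - s) ^ 2) ^ (r / 2) ≤ 1 + s ^ 2 := by
    have h3 : 1 / 2 * (1 + s) ^ 2 + 1 / 2 * (1 - s) ^ 2 = 1 + s ^ 2 := by ring
    rw [h3]
    exact Real.rpow_le_self_of_one_le (by nlinarith) (by linarith)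
  linarith

/-- A quantitative convexity inequality for scalars and exponents `r ≥ 2`: by the parallelogram law
and the convexity of `x ↦ x ^ (r / 2)`, the mean of `‖a ± b‖ ^ r` is at least
`(‖a‖² + ‖b‖²) ^ (r / 2)`; Bernoulli's inequality does the rest. -/
theorem two_mul_norm_rpow_add_le {𝕜 : Type*} [RCLike 𝕜] {r : ℝ} (hr : 2 ≤ r) {a : 𝕜}
    (ha : a ≠ 0) (b : 𝕜) :
    2 * ‖a‖ ^ r + r * ‖a‖ ^ (r - 2) * ‖b‖ ^ 2 ≤ ‖a + b‖ ^ r + ‖a - b‖ ^ r := by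
  have ha' : 0 < ‖a‖ := norm_pos_iff.2 ha
  have h0 : ∀ a : ℝ, 0 ≤ a → a ^ r = (a ^ 2) ^ (r / 2) := fun a ha => by
    rw [← Real.rpow_natCast, ← Real.rpow_mul ha]
    congr 1
    push_cast
    ring
  have h1 := (convexOn_rpow (p := r / 2) (by linarith)).2
    (sq_nonneg ‖a + b‖) (sq_nonneg ‖a - b‖)
    (by norm_num : (0 : ℝ) ≤ 1 / 2) (by norm_num : (0 : ℝ) ≤ 1 / 2) (by norm_num)
  simp only [smul_eq_mul] at h1
  rw [h0 ‖a + b‖ (norm_nonneg _), h0 ‖a - b‖ (norm_nonneg _)]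
  have h3 : 1 / 2 * ‖a + b‖ ^ 2 + 1 / 2 * ‖a - b‖ ^ 2 = ‖a‖ ^ 2 * (1 + (‖b‖ / ‖a‖) ^ 2) := by
    have := parallelogram_law_with_norm 𝕜 a b
    field_simp
    linarith
  have h4 := one_add_mul_self_le_rpow_one_add (s := (‖b‖ / ‖a‖) ^ 2) (p := r / 2)
    (by linarith [sq_nonneg (‖b‖ / ‖a‖)]) (by linarith)
  rw [h3, Real.mul_rpow (by positivity) (by positivity), ← h0 _ ha'.le] at h1
  have h5 : ‖a‖ ^ r * (1 + r / 2 * (‖b‖ / ‖a‖) ^ 2) ≤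
      ‖a‖ ^ r * (1 + (‖b‖ / ‖a‖) ^ 2) ^ (r / 2) := by gcongr
  have h6 : ‖a‖ ^ (r - 2) = ‖a‖ ^ r / ‖a‖ ^ 2 := by
    rw [Real.rpow_sub ha', Real.rpow_two]
  have h7 : 2 * ‖a‖ ^ r + r * ‖a‖ ^ (r - 2) * ‖b‖ ^ 2 =
      2 * (‖a‖ ^ r * (1 + r / 2 * (‖b‖ / ‖a‖) ^ 2)) := by
    rw [h6]
    field_simp
  linarith

variable {𝕜 : Type*} [RCLike 𝕜] {p : ℝ≥0∞} [Fact (1 ≤ p)] {ι : Type*} {l : Filter ι}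

/-- Asymptotic additivity of `‖·‖ ^ p` along coordinatewise null perturbations of a vector with
finite support. -/
theorem tendsto_norm_add_rpow_sub (hp : 0 < p.toReal) {K : ℕ} {v : SeqLp 𝕜 p}
    (hv : coordRestrict (Set.Iio K) v = v) {h : ι → SeqLp 𝕜 p}
    (hh : ∀ k, Tendsto (fun i => h i k) l (𝓝 0)) :
    Tendsto (fun i => ‖v + h i‖ ^ p.toReal - ‖h i‖ ^ p.toReal) l (𝓝 (‖v‖ ^ p.toReal)) := by
  have hP : Tendsto (fun i => coordRestrict (Set.Iio K) (h i)) l (𝓝 0) := by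
    have := tendsto_coordRestrict_Iio_of_coord (v := 0) hh K
    rwa [map_zero] at this
  have hv0 : coordRestrict (Set.Iio K)ᶜ v = 0 :=
    coordRestrict_eq_zero_of_disjoint disjoint_compl_left hv
  have heq : ∀ i, ‖v + h i‖ ^ p.toReal - ‖h i‖ ^ p.toReal =
      ‖v + coordRestrict (Set.Iio K) (h i)‖ ^ p.toReal -
        ‖coordRestrict (Set.Iio K) (h i)‖ ^ p.toReal := fun i => by
    rw [norm_rpow_eq_coordRestrict hp (Set.Iio K) (v + h i),
      norm_rpow_eq_coordRestrict hp (Set.Iio K) (h i), map_add, map_add, hv, hv0, zero_add]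
    ring
  simp only [heq]
  have h1 := ((hP.const_add v).norm.rpow_const (p := p.toReal) (Or.inr hp.le)).sub
    (hP.norm.rpow_const (p := p.toReal) (Or.inr hp.le))
  simpa [Real.zero_rpow hp.ne'] using h1

/-- For `p < 2`, contractions converging coordinatewise to a contraction `T` converge in norm at
the basis vector `e_n` as soon as `T` attains its norm at some `y` with `y n ≠ 0`. With
`w± = y ± s y_n e_n`, the defects `S w± - T w±` can only use the room
`‖w₊‖ ^ p + ‖w₋‖ ^ p - 2 ‖y‖ ^ p = O(s²)`, whereas their difference has size
`s ‖S e_n - T e_n‖`. -/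
theorem tendsto_apply_single_of_norming (hp1 : 1 ≤ p.toReal) (hp2 : p.toReal < 2)
    {S : ι → SeqLp 𝕜 p →L[𝕜] SeqLp 𝕜 p} {T : SeqLp 𝕜 p →L[𝕜] SeqLp 𝕜 p} (hS : ∀ i, ‖S i‖ ≤ 1)
    (hST : ∀ x k, Tendsto (fun i => S i x k) l (𝓝 (T x k))) {K n : ℕ} {y : SeqLp 𝕜 p}
    (hy : ‖T y‖ = ‖y‖) (hyn : y n ≠ 0) (hTy : coordRestrict (Set.Iio K) (T y) = T y)
    (hTe : coordRestrict (Set.Iio K) (T (lp.single p n 1)) = T (lp.single p n 1)) :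
    Tendsto (fun i => S i (lp.single p n 1)) l (𝓝 (T (lp.single p n 1))) := by
  have hp0 : 0 < p.toReal := zero_lt_one.trans_le hp1
  have ha : 0 < ‖y n‖ := norm_pos_iff.2 hyn
  set e : SeqLp 𝕜 p := lp.single p n 1 with he
  have key : ∀ s : ℝ, 0 < s → s ≤ 1 → ∀ᶠ i in l,
      ‖S i e - T e‖ ≤ 3 * s ^ (2 / p.toReal - 1) := by
    intro s hs hs1
    set c : 𝕜 := (s : 𝕜) * y n with hc
    have hdef : ∀ w, coordRestrict (Set.Iio K) (T w) = T w →
        Tendsto (fun i => ‖T w + (S i w - T w)‖ ^ p.toReal - ‖S i w - T w‖ ^ p.toReal) l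
          (𝓝 (‖T w‖ ^ p.toReal)) := fun w hw =>
      tendsto_norm_add_rpow_sub hp0 hw fun k => by
        simpa using (hST w k).sub_const (T w k)
    have hlim := (hdef (y + c • e) (by simp only [map_add, map_smul, hTy, hTe])).add
      (hdef (y - c • e) (by simp only [map_sub, map_smul, hTy, hTe]))
    have hconv := two_mul_norm_rpow_le (E := SeqLp 𝕜 p) hp1 (T y) (T (c • e))
    rw [← map_add, ← map_sub, hy] at hconv
    have hsq : 0 < s ^ 2 * ‖y n‖ ^ p.toReal := by positivity
    -- The error allowed in the limit is `s² |y n| ^ p`, the order of the bound to be shown.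
    filter_upwards [hlim.eventually_const_lt
      (show ‖T (y + c • e)‖ ^ p.toReal + ‖T (y - c • e)‖ ^ p.toReal - s ^ 2 * ‖y n‖ ^ p.toReal
        < _ by linarith)] with i hi
    simp only [add_sub_cancel] at hi
    have hcontr : ∀ w, ‖S i w‖ ^ p.toReal ≤ ‖w‖ ^ p.toReal := fun w =>
      Real.rpow_le_rpow (norm_nonneg _) (by simpa using (S i).le_of_opNorm_le (hS i) w) hp0.le
    have hQe : coordRestrict {n}ᶜ (c • e) = 0 := by
      rw [map_smul, coordRestrict_single_of_notMem (by simp), smul_zero]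
    have hen : (c • e) n = c := by
      simp [he]
    have hw1 : ‖y + c • e‖ ^ p.toReal =
        ‖y n‖ ^ p.toReal * (1 + s) ^ p.toReal + ‖coordRestrict {n}ᶜ y‖ ^ p.toReal := by
      rw [norm_rpow_eq_compl_singleton hp0 n, map_add, hQe, add_zero, lp.coeFn_add, Pi.add_apply,
        hen, ← Real.mul_rpow (norm_nonneg _) (by linarith)]
      congr 2
      rw [hc, show y n + (s : 𝕜) * y n = ((1 + s : ℝ) : 𝕜) * y n by push_cast; ring, norm_mul,
        RCLike.norm_ofReal, abs_of_nonneg (by linarith), mul_comm]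
    have hw2 : ‖y - c • e‖ ^ p.toReal =
        ‖y n‖ ^ p.toReal * (1 - s) ^ p.toReal + ‖coordRestrict {n}ᶜ y‖ ^ p.toReal := by
      rw [norm_rpow_eq_compl_singleton hp0 n, map_sub, hQe, sub_zero, lp.coeFn_sub, Pi.sub_apply,
        hen, ← Real.mul_rpow (norm_nonneg _) (by linarith)]
      congr 2
      rw [hc, show y n - (s : 𝕜) * y n = ((1 - s : ℝ) : 𝕜) * y n by push_cast; ring, norm_mul,
        RCLike.norm_ofReal, abs_of_nonneg (by linarith), mul_comm]
    have hy' := norm_rpow_eq_compl_singleton hp0 n y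
    have hs2 := mul_le_mul_of_nonneg_left
      (one_add_rpow_add_one_sub_rpow_le hp0.le hp2.le hs.le hs1)
      (by positivity : 0 ≤ ‖y n‖ ^ p.toReal)
    have hsum : ‖S i (y + c • e) - T (y + c • e)‖ ^ p.toReal +
        ‖S i (y - c • e) - T (y - c • e)‖ ^ p.toReal ≤ 3 * (s ^ 2 * ‖y n‖ ^ p.toReal) := by
      have h1 := hcontr (y + c • e)
      have h2 := hcontr (y - c • e)
      rw [hw1] at h1
      rw [hw2] at h2
      linarith
    -- The constant `3` is crude: `3 ^ (1 / p) ≤ 3`.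
    have hroot : ∀ b : ℝ, 0 ≤ b → b ^ p.toReal ≤ 3 * (s ^ 2 * ‖y n‖ ^ p.toReal) →
        b ≤ 3 * s ^ (2 / p.toReal) * ‖y n‖ := by
      intro b hb hbr
      rw [← Real.rpow_le_rpow_iff hb (by positivity) hp0]
      refine hbr.trans ?_
      rw [Real.mul_rpow (by positivity) (by positivity), Real.mul_rpow (by positivity)
        (by positivity), ← Real.rpow_mul hs.le, div_mul_cancel₀ _ hp0.ne', Real.rpow_two,
        mul_assoc]
      gcongr
      exact Real.self_le_rpow_of_one_le (by norm_num) hp1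
    have hd1 := hroot _ (norm_nonneg (S i (y + c • e) - T (y + c • e))) (by
      linarith [Real.rpow_nonneg (norm_nonneg (S i (y - c • e) - T (y - c • e))) p.toReal])
    have hd2 := hroot _ (norm_nonneg (S i (y - c • e) - T (y - c • e))) (by
      linarith [Real.rpow_nonneg (norm_nonneg (S i (y + c • e) - T (y + c • e))) p.toReal])
    have hdiff : (2 * c) • (S i e - T e) =
        (S i (y + c • e) - T (y + c • e)) - (S i (y - c • e) - T (y - c • e)) := by
      simp only [map_add, map_sub, map_smul, smul_sub, two_mul, add_smul]
      abel
    have hfin := norm_sub_le (S i (y + c • e) - T (y + c • e)) (S i (y - c • e) - T (y - c • e))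
    rw [← hdiff, norm_smul, norm_mul, hc, norm_mul, RCLike.norm_ofReal, abs_of_pos hs,
      RCLike.norm_two] at hfin
    have hsr : s ^ (2 / p.toReal) = s * s ^ (2 / p.toReal - 1) := by
      rw [Real.rpow_sub_one hs.ne']
      field_simp
    rw [hsr] at hd1 hd2
    have : (2 * (s * ‖y n‖)) * ‖S i e - T e‖ ≤
        (2 * (s * ‖y n‖)) * (3 * s ^ (2 / p.toReal - 1)) := by linarith
    exact le_of_mul_le_mul_left this (by positivity)
  rw [tendsto_iff_norm_sub_tendsto_zero, Metric.tendsto_nhds]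
  intro ε hε
  have hexp : 0 < 2 / p.toReal - 1 := by
    rw [sub_pos, lt_div_iff₀ hp0]
    linarith
  have h0 : Tendsto (fun s : ℝ => 3 * s ^ (2 / p.toReal - 1)) (𝓝[>] 0) (𝓝 (3 * 0)) := by
    refine Tendsto.const_mul _ (tendsto_nhdsWithin_of_tendsto_nhds ?_)
    have := (Real.continuousAt_rpow_const 0 (2 / p.toReal - 1) (Or.inr hexp.le)).tendsto
    rwa [Real.zero_rpow hexp.ne'] at this
  rw [mul_zero] at h0
  obtain ⟨s, h1, h2, h3⟩ := ((h0.eventually_lt_const hε).and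
    (Ioc_mem_nhdsGT (zero_lt_one (α := ℝ)))).exists
  filter_upwards [key s h2 h3] with i hi
  rw [dist_zero_right, norm_norm]
  exact hi.trans_lt h1

/-- For `p > 2`, if `T` attains its norm at `y` and `(T y) n ≠ 0`, then the `n`-th rows of
contractions close to `T` coordinatewise have uniformly small tails: adding `± t u` to `y` with `u`
supported far away costs `t ^ p`, whereas it increases `‖S y‖ ^ p` on average by at least a multiple
of `t² ‖(S u) n‖²`. -/
theorem eventually_norm_apply_le_of_norming (hp2 : 2 < p.toReal)
    {S : ι → SeqLp 𝕜 p →L[𝕜] SeqLp 𝕜 p} {T : SeqLp 𝕜 p →L[𝕜] SeqLp 𝕜 p} (hS : ∀ i, ‖S i‖ ≤ 1)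
    (hST : ∀ x k, Tendsto (fun i => S i x k) l (𝓝 (T x k))) {K n : ℕ} {y : SeqLp 𝕜 p}
    (hyK : coordRestrict (Set.Iio K) y = y)
    (hy : ‖T y‖ = ‖y‖) (hyn : T y n ≠ 0) (hTy : coordRestrict (Set.Iio K) (T y) = T y)
    {ε : ℝ} (hε : 0 < ε) :
    ∀ᶠ i in l, ∀ u, coordRestrict (Set.Iio K) u = 0 → ‖u‖ ≤ 1 → ‖S i u n‖ ≤ ε := by
  have hp0 : 0 < p.toReal := by linarith
  set r := p.toReal with hr
  have ha : 0 < ‖T y n‖ := norm_pos_iff.2 hyn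
  set a := ‖T y n‖ ^ (r - 2) with hadef
  have ha' : 0 < a := Real.rpow_pos_of_pos ha _
  obtain ⟨t, ht, htε⟩ : ∃ t : ℝ, 0 < t ∧ 4 * t ^ (r - 2) < r * (a / 2) * ε ^ 2 := by
    have h : Tendsto (fun t : ℝ => 4 * t ^ (r - 2)) (𝓝[>] 0) (𝓝 (4 * 0)) := by
      refine Tendsto.const_mul _ (tendsto_nhdsWithin_of_tendsto_nhds ?_)
      have := (Real.continuousAt_rpow_const 0 (r - 2) (Or.inr (by linarith))).tendsto
      rwa [Real.zero_rpow (by linarith)] at this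
    rw [mul_zero] at h
    obtain ⟨τ, h1, h2⟩ := ((h.eventually_lt_const
      (by positivity : 0 < r * (a / 2) * ε ^ 2)).and self_mem_nhdsWithin).exists
    exact ⟨τ, h2, h1⟩
  have hlim1 : Tendsto (fun i => ‖coordRestrict (Set.Iio K) (S i y)‖ ^ r) l (𝓝 (‖y‖ ^ r)) := by
    have := tendsto_coordRestrict_Iio_of_coord (hST y) K
    rw [hTy] at this
    rw [← hy]
    exact this.norm.rpow_const (Or.inr hp0.le)
  have hlim2 : Tendsto (fun i => ‖S i y n‖ ^ (r - 2)) l (𝓝 a) :=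
    (hST y n).norm.rpow_const (Or.inl ha.ne')
  filter_upwards [hlim1.eventually_const_lt
      (show ‖y‖ ^ r - t ^ r < _ from sub_lt_self _ (Real.rpow_pos_of_pos ht _)),
    hlim2.eventually_const_lt (half_lt_self ha'),
    (hST y n).eventually_ne hyn] with i h1 h2 h3 u hu hu1
  have hcontr : ∀ w, ‖S i w‖ ^ r ≤ ‖w‖ ^ r := fun w =>
    Real.rpow_le_rpow (norm_nonneg _) (by simpa using (S i).le_of_opNorm_le (hS i) w) hp0.le
  set v : SeqLp 𝕜 p := (t : 𝕜) • u with hv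
  have hvt : ‖v‖ ^ r ≤ t ^ r := by
    refine Real.rpow_le_rpow (norm_nonneg _) ?_ hp0.le
    rw [hv, norm_smul, RCLike.norm_ofReal, abs_of_pos ht]
    exact mul_le_of_le_one_right ht.le hu1
  have hv0 : coordRestrict (Set.Iio K) v = 0 := by rw [hv, map_smul, hu, smul_zero]
  have hplus := hcontr (y + v)
  rw [norm_rpow_add_of_coordRestrict hp0 hyK hv0] at hplus
  have hminus := hcontr (y - v)
  rw [sub_eq_add_neg y v, norm_rpow_add_of_coordRestrict hp0 hyK (by rw [map_neg, hv0, neg_zero]),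
    norm_neg, ← sub_eq_add_neg] at hminus
  rw [map_add, norm_rpow_eq_compl_singleton hp0 n, map_add, lp.coeFn_add, Pi.add_apply] at hplus
  rw [map_sub, norm_rpow_eq_compl_singleton hp0 n, map_sub, lp.coeFn_sub, Pi.sub_apply] at hminus
  have hrest := two_mul_norm_rpow_le (E := SeqLp 𝕜 p) (r := r) (by linarith)
    (coordRestrict {n}ᶜ (S i y)) (coordRestrict {n}ᶜ (S i v))
  have hcoord := two_mul_norm_rpow_add_le hp2.le h3 (S i v n)
  have hSy := norm_rpow_eq_compl_singleton hp0 n (S i y)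
  have hSyK : ‖coordRestrict (Set.Iio K) (S i y)‖ ^ r ≤ ‖S i y‖ ^ r :=
    Real.rpow_le_rpow (norm_nonneg _) (norm_coordRestrict_apply_le _ _) hp0.le
  -- Two units of `t ^ p` come from `‖y ± v‖ ^ p`, two from the error in `2 ‖S y‖ ^ p`.
  have hmain : r * ‖S i y n‖ ^ (r - 2) * ‖S i v n‖ ^ 2 ≤ 4 * t ^ r := by linarith
  have hSv : ‖S i v n‖ = t * ‖S i u n‖ := by
    rw [hv, map_smul, lp.coeFn_smul, Pi.smul_apply, norm_smul, RCLike.norm_ofReal, abs_of_pos ht]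
  have htr : t ^ r = t ^ 2 * t ^ (r - 2) := by
    rw [Real.rpow_sub ht, Real.rpow_two]
    field_simp
  have h5 : t ^ 2 * (r * (a / 2) * ‖S i u n‖ ^ 2) ≤ t ^ 2 * (4 * t ^ (r - 2)) := by
    calc t ^ 2 * (r * (a / 2) * ‖S i u n‖ ^ 2)
        ≤ t ^ 2 * (r * ‖S i y n‖ ^ (r - 2) * ‖S i u n‖ ^ 2) := by gcongr
      _ = r * ‖S i y n‖ ^ (r - 2) * ‖S i v n‖ ^ 2 := by rw [hSv]; ring
      _ ≤ _ := by rw [htr] at hmain; linarith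
  have h6 := le_of_mul_le_mul_left h5 (by positivity)
  have h7 : ‖S i u n‖ ^ 2 < ε ^ 2 := lt_of_mul_lt_mul_left (h6.trans_lt htε) (by positivity)
  exact (lt_of_pow_lt_pow_left₀ 2 hε.le h7).le

/-- If the `n`-th rows of contractions converge coordinatewise and have uniformly small tails, then
they converge in norm. -/
theorem tendsto_evalCLM_comp (hp1 : 1 < p.toReal) (hp_top : p ≠ ⊤)
    {S : ι → SeqLp 𝕜 p →L[𝕜] SeqLp 𝕜 p} {T : SeqLp 𝕜 p →L[𝕜] SeqLp 𝕜 p}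
    (hST : ∀ x k, Tendsto (fun i => S i x k) l (𝓝 (T x k))) {K n : ℕ}
    (htail : ∀ ε > 0, ∀ᶠ i in l, ∀ u, coordRestrict (Set.Iio K) u = 0 → ‖u‖ ≤ 1 →
      ‖S i u n‖ ≤ ε) :
    Tendsto (fun i => (lp.evalCLM 𝕜 (fun _ : ℕ => 𝕜) p n).comp (S i)) l
      (𝓝 ((lp.evalCLM 𝕜 (fun _ : ℕ => 𝕜) p n).comp T)) := by
  set φ := lp.evalCLM 𝕜 (fun _ : ℕ => 𝕜) p n with hφ
  rw [tendsto_iff_norm_sub_tendsto_zero, Metric.tendsto_nhds]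
  intro ε hε
  obtain ⟨M, hKM, hTM⟩ := ((eventually_ge_atTop K).and
    ((tendsto_norm_comp_coordRestrict_compl hp1 hp_top (φ.comp T)).eventually_lt_const
      (by positivity : 0 < ε / 4))).exists
  have hhead : Tendsto (fun i => ∑ k ∈ Finset.range M,
      ‖S i (lp.single p k 1) n - T (lp.single p k 1) n‖) l (𝓝 0) := by
    rw [← Finset.sum_const_zero (s := Finset.range M)]
    exact tendsto_finsetSum _ fun k _ => tendsto_iff_norm_sub_tendsto_zero.1 (hST _ n)
  filter_upwards [htail (ε / 4) (by positivity),
    hhead.eventually_lt_const (by positivity : 0 < ε / 4)] with i h1 h2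
  rw [dist_zero_right, norm_norm]
  refine lt_of_le_of_lt (ContinuousLinearMap.opNorm_le_bound _
    (by positivity : 0 ≤ 3 * (ε / 4)) fun x => ?_) (by linarith)
  have hx : x = ∑ k ∈ Finset.range M, x k • (lp.single p k 1 : SeqLp 𝕜 p) +
      coordRestrict (Set.Iio M)ᶜ x := by
    conv_lhs => rw [← coordRestrict_add_compl (Set.Iio M) x, coordRestrict_Iio]
    simp only [← lp.single_smul, smul_eq_mul, mul_one]
  set v := coordRestrict (Set.Iio M)ᶜ x with hv
  have hvx : ‖v‖ ≤ ‖x‖ := norm_coordRestrict_apply_le _ _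
  have hSv : ‖φ (S i v)‖ ≤ ε / 4 * ‖x‖ := by
    rcases eq_or_ne v 0 with h0 | h0
    · rw [h0, map_zero, map_zero, norm_zero]
      positivity
    have hv' : 0 < ‖v‖ := norm_pos_iff.2 h0
    have h3 := h1 (((‖v‖⁻¹ : ℝ) : 𝕜) • v) (by
        have : coordRestrict (Set.Iio K) v = 0 := coordRestrict_eq_zero_iff.2 fun k hk =>
          coordRestrict_apply_of_notMem (fun h : k ∈ (Set.Iio M)ᶜ => h (lt_of_lt_of_le hk hKM)) x
        rw [map_smul, this, smul_zero]) (by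
        rw [norm_smul, RCLike.norm_ofReal, abs_of_pos (inv_pos.2 hv'), inv_mul_cancel₀ hv'.ne'])
    rw [map_smul, lp.coeFn_smul, Pi.smul_apply, norm_smul, RCLike.norm_ofReal,
      abs_of_pos (inv_pos.2 hv'), inv_mul_le_iff₀ hv'] at h3
    calc ‖φ (S i v)‖ ≤ ‖v‖ * (ε / 4) := h3
      _ ≤ ε / 4 * ‖x‖ := by rw [mul_comm]; gcongr
  have hTv : ‖φ (T v)‖ ≤ ε / 4 * ‖x‖ :=
    ((φ.comp T).comp (coordRestrict (Set.Iio M)ᶜ)).le_of_opNorm_le hTM.le x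
  have hsum : ‖∑ k ∈ Finset.range M, x k • (φ (S i (lp.single p k 1)) - φ (T (lp.single p k 1)))‖ ≤
      ε / 4 * ‖x‖ := by
    refine (norm_sum_le _ _).trans ?_
    calc ∑ k ∈ Finset.range M, ‖x k • (φ (S i (lp.single p k 1)) - φ (T (lp.single p k 1)))‖
        ≤ ∑ k ∈ Finset.range M, ‖x‖ * ‖S i (lp.single p k 1) n - T (lp.single p k 1) n‖ := by
          refine Finset.sum_le_sum fun k _ => ?_
          rw [norm_smul]
          exact mul_le_mul_of_nonneg_right
            (lp.norm_apply_le_norm (zero_lt_one.trans_le Fact.out).ne' x k) (norm_nonneg _)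
      _ ≤ ε / 4 * ‖x‖ := by
          rw [← Finset.mul_sum, mul_comm]
          gcongr
  have hdec : (φ.comp (S i) - φ.comp T) x =
      ∑ k ∈ Finset.range M, x k • (φ (S i (lp.single p k 1)) - φ (T (lp.single p k 1))) +
        (φ (S i v) - φ (T v)) := by
    conv_lhs => rw [hx]
    simp only [sub_apply, ContinuousLinearMap.comp_apply, map_add, map_sum,
      map_smul, smul_sub, Finset.sum_sub_distrib]
  rw [hdec]
  linarith [norm_add_le (∑ k ∈ Finset.range M,
    x k • (φ (S i (lp.single p k 1)) - φ (T (lp.single p k 1)))) (φ (S i v) - φ (T v)),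
    norm_sub_le (φ (S i v)) (φ (T v))]

theorem comp_coordRestrict_Iio_eq_sum (f : StrongDual 𝕜 (SeqLp 𝕜 p)) (N : ℕ) :
    f.comp (coordRestrict (Set.Iio N)) = ∑ k ∈ Finset.range N,
      f (lp.single p k 1) • lp.evalCLM 𝕜 (fun _ : ℕ => 𝕜) p k := by
  ext x
  rw [ContinuousLinearMap.comp_apply, coordRestrict_Iio, map_sum, sum_apply]
  refine Finset.sum_congr rfl fun k _ => ?_
  have : (lp.single p k (x k) : SeqLp 𝕜 p) = x k • lp.single p k 1 := by
    rw [← lp.single_smul, smul_eq_mul, mul_one]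
  rw [this, map_smul, smul_eq_mul, mul_comm]
  rfl

theorem tendsto_comp_coordRestrict_Iio (hp1 : 1 < p.toReal) (hp_top : p ≠ ⊤)
    (f : StrongDual 𝕜 (SeqLp 𝕜 p)) :
    Tendsto (fun N => f.comp (coordRestrict (Set.Iio N))) atTop (𝓝 f) := by
  rw [tendsto_iff_norm_sub_tendsto_zero]
  refine (tendsto_norm_comp_coordRestrict_compl hp1 hp_top f).congr fun N => ?_
  rw [← norm_neg]
  congr 1
  ext x
  have := congrArg f (coordRestrict_add_compl (Set.Iio N) x)
  rw [map_add] at this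
  simp [← this]

/-- For every `n` the operator attains the bound `‖T y‖ ≤ ‖y‖` of a contraction at some `y` with
`y n ≠ 0`. The images of `y` and of the basis vector `e_n` are required to have finite support,
which makes the norm of a coordinatewise null perturbation of them asymptotically additive. -/
structure NormsInputs (T : SeqLp 𝕜 p →L[𝕜] SeqLp 𝕜 p) : Prop where
  exists_norming : ∀ n, ∃ y K, ‖T y‖ = ‖y‖ ∧ y n ≠ 0 ∧
    coordRestrict (Set.Iio K) (T y) = T y ∧
    coordRestrict (Set.Iio K) (T (lp.single p n 1)) = T (lp.single p n 1)

/-- For every `n` the operator attains the bound `‖T y‖ ≤ ‖y‖` of a contraction at some `y` with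
`T y n ≠ 0`. Both `y` and `T y` are required to have finite support, so that vectors supported far
away are disjoint from `y`. -/
structure NormsOutputs (T : SeqLp 𝕜 p →L[𝕜] SeqLp 𝕜 p) : Prop where
  exists_norming : ∀ n, ∃ y K, ‖T y‖ = ‖y‖ ∧ T y n ≠ 0 ∧
    coordRestrict (Set.Iio K) y = y ∧ coordRestrict (Set.Iio K) (T y) = T y

theorem tendsto_coord_nhds_WOT (T : OpBall 𝕜 (SeqLp 𝕜 p)) (x : SeqLp 𝕜 p) (k : ℕ) :
    Tendsto (fun S : OpBall 𝕜 (SeqLp 𝕜 p) => S.1 x k) (@nhds _ (OpTopology.WOT 𝕜 (SeqLp 𝕜 p)) T)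
      (𝓝 (T.1 x k)) :=
  tendsto_nhds_WOT.1 (tendsto_id (x := @nhds _ (OpTopology.WOT 𝕜 (SeqLp 𝕜 p)) T)) x
    (lp.evalCLM 𝕜 (fun _ : ℕ => 𝕜) p k)

theorem NormsInputs.mem_continuityPoints (hp2 : p < 2) {T : OpBall 𝕜 (SeqLp 𝕜 p)}
    (hT : NormsInputs T.1) :
    T ∈ continuityPoints (OpTopology.WOT 𝕜 (SeqLp 𝕜 p)) (OpTopology.SOT 𝕜 (SeqLp 𝕜 p)) := by
  have hp_top : p ≠ ⊤ := (hp2.trans ENNReal.ofNat_lt_top).ne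
  have h1 : 1 ≤ p.toReal := by
    simpa using (ENNReal.toReal_le_toReal ENNReal.one_ne_top hp_top).2 (Fact.out : 1 ≤ p)
  have h2 : p.toReal < 2 := by
    simpa using (ENNReal.toReal_lt_toReal hp_top ENNReal.ofNat_ne_top).2 hp2
  refine tendsto_nhds_SOT.2 fun x => ?_
  refine tendsto_apply_of_tendsto_seq (fun S => S.2) T.2
    (tendsto_coordRestrict_Iio hp_top x) fun N => ?_
  have hsum : coordRestrict (Set.Iio N) x =
      ∑ k ∈ Finset.range N, x k • (lp.single p k 1 : SeqLp 𝕜 p) := by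
    simp only [coordRestrict_Iio, ← lp.single_smul, smul_eq_mul, mul_one]
  simp only [hsum, map_sum, map_smul]
  refine tendsto_finsetSum _ fun n _ => Tendsto.const_smul ?_ _
  obtain ⟨y, K, hy, hyn, hTy, hTe⟩ := hT.exists_norming n
  exact tendsto_apply_single_of_norming h1 h2 (fun S => S.2) (tendsto_coord_nhds_WOT T) hy hyn
    hTy hTe

theorem NormsOutputs.mem_continuityPoints (hp2 : 2 < p) (hp_top : p ≠ ⊤)
    {T : OpBall 𝕜 (SeqLp 𝕜 p)} (hT : NormsOutputs T.1) :
    T ∈ continuityPoints (OpTopology.WOT 𝕜 (SeqLp 𝕜 p))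
      (OpTopology.SOTLowerStar 𝕜 (SeqLp 𝕜 p)) := by
  have h2 : 2 < p.toReal := by
    simpa using (ENNReal.toReal_lt_toReal ENNReal.ofNat_ne_top hp_top).2 hp2
  have h1 : 1 < p.toReal := by linarith
  refine tendsto_nhds_SOTLowerStar.2 fun f => ?_
  have hprecomp : ∀ S : OpBall 𝕜 (SeqLp 𝕜 p), ‖(S.1.precomp 𝕜 :
      StrongDual 𝕜 (SeqLp 𝕜 p) →L[𝕜] StrongDual 𝕜 (SeqLp 𝕜 p))‖ ≤ 1 := fun S =>
    ContinuousLinearMap.opNorm_le_bound _ zero_le_one fun f => by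
      rw [one_mul]
      exact (f.opNorm_comp_le S.1).trans (mul_le_of_le_one_right (norm_nonneg _) S.2)
  refine tendsto_apply_of_tendsto_seq hprecomp (hprecomp T)
    (tendsto_comp_coordRestrict_Iio h1 hp_top f) fun N => ?_
  simp only [comp_coordRestrict_Iio_eq_sum, map_sum, map_smul]
  refine tendsto_finsetSum _ fun n _ => Tendsto.const_smul ?_ _
  obtain ⟨y, K, hy, hyn, hyK, hTy⟩ := hT.exists_norming n
  exact tendsto_evalCLM_comp h1 hp_top (tendsto_coord_nhds_WOT T) fun ε hε =>
    eventually_norm_apply_le_of_norming h2 (fun S => S.2) (tendsto_coord_nhds_WOT T) hyK hy hyn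
      hTy hε

end Criteria

/-! ### Density of the operators with enough norm-attaining vectors -/

section Density

variable {𝕜 : Type*} [RCLike 𝕜] {p : ℝ≥0∞} [Fact (1 ≤ p)]

/-- Operators on `ℓ_p` given by a matrix whose entries vanish outside `s × s`. -/
def matrixSupported (𝕜 : Type*) [RCLike 𝕜] (p : ℝ≥0∞) [Fact (1 ≤ p)] (s : Set ℕ) :
    Set (SeqLp 𝕜 p →L[𝕜] SeqLp 𝕜 p) :=
  {A | (∀ x, A (coordRestrict s x) = A x) ∧ ∀ x, coordRestrict s (A x) = A x}

theorem add_mem_matrixSupported {s : Set ℕ} {A B : SeqLp 𝕜 p →L[𝕜] SeqLp 𝕜 p}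
    (hA : A ∈ matrixSupported 𝕜 p s) (hB : B ∈ matrixSupported 𝕜 p s) :
    A + B ∈ matrixSupported 𝕜 p s :=
  ⟨fun x => by rw [add_apply, hA.1, hB.1, add_apply],
    fun x => by rw [add_apply, map_add, hA.2, hB.2]⟩

theorem smul_mem_matrixSupported {s : Set ℕ} {A : SeqLp 𝕜 p →L[𝕜] SeqLp 𝕜 p} (c : 𝕜)
    (hA : A ∈ matrixSupported 𝕜 p s) : c • A ∈ matrixSupported 𝕜 p s :=
  ⟨fun x => by rw [smul_apply, hA.1, smul_apply], fun x => by rw [smul_apply, map_smul, hA.2]⟩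

theorem smulRight_mem_matrixSupported {s : Set ℕ} {f : StrongDual 𝕜 (SeqLp 𝕜 p)} {z : SeqLp 𝕜 p}
    (hf : ∀ x, f (coordRestrict s x) = f x) (hz : coordRestrict s z = z) :
    f.smulRight z ∈ matrixSupported 𝕜 p s :=
  ⟨fun x => by simp only [ContinuousLinearMap.smulRight_apply, hf],
    fun x => by simp only [ContinuousLinearMap.smulRight_apply, map_smul, hz]⟩

theorem norm_apply_le_of_norm_le_one {E F : Type*} [NormedAddCommGroup E] [NormedSpace 𝕜 E]
    [NormedAddCommGroup F] [NormedSpace 𝕜 F] {A : E →L[𝕜] F} (hA : ‖A‖ ≤ 1) (x : E) :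
    ‖A x‖ ≤ ‖x‖ := by
  simpa using A.le_of_opNorm_le hA x

/-- The direct sum of a contraction living on the coordinates in `t` and of the identity on a
disjoint set of coordinates is a contraction. -/
theorem norm_add_coordRestrict_le_one (hp : 0 < p.toReal) {s t : Set ℕ} (hst : Disjoint t s)
    {A : SeqLp 𝕜 p →L[𝕜] SeqLp 𝕜 p} (hA : A ∈ matrixSupported 𝕜 p t) (hA1 : ‖A‖ ≤ 1) :
    ‖A + coordRestrict s‖ ≤ 1 := by
  refine ContinuousLinearMap.opNorm_le_bound _ zero_le_one fun x => ?_
  rw [one_mul, add_apply, ← Real.rpow_le_rpow_iff (norm_nonneg _) (norm_nonneg _) hp,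
    norm_rpow_add_of_coordRestrict hp (hA.2 x)
      (coordRestrict_eq_zero_of_disjoint hst (coordRestrict_idem s x)),
    norm_rpow_eq_coordRestrict hp t x, ← hA.1 x]
  have h1 : coordRestrict s x = coordRestrict s (coordRestrict tᶜ x) := by
    rw [coordRestrict_coordRestrict, Set.inter_eq_left.2 hst.subset_compl_left]
  rw [h1]
  exact add_le_add
    (Real.rpow_le_rpow (norm_nonneg _) (norm_apply_le_of_norm_le_one hA1 _) hp.le)
    (Real.rpow_le_rpow (norm_nonneg _) (norm_coordRestrict_apply_le _ _) hp.le)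

theorem coordRestrict_comm (s t : Set ℕ) (x : SeqLp 𝕜 p) :
    coordRestrict s (coordRestrict t x) = coordRestrict t (coordRestrict s x) := by
  rw [coordRestrict_coordRestrict, coordRestrict_coordRestrict, Set.inter_comm]

theorem norm_evalCLM_le (n : ℕ) : ‖lp.evalCLM 𝕜 (fun _ : ℕ => 𝕜) p n‖ ≤ 1 :=
  ContinuousLinearMap.opNorm_le_bound _ zero_le_one fun x => by
    rw [one_mul]
    exact lp.norm_apply_le_norm (zero_lt_one.trans_le Fact.out).ne' x n

theorem norm_comp_coordRestrict_le (s : Set ℕ) (A : SeqLp 𝕜 p →L[𝕜] SeqLp 𝕜 p) :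
    ‖A.comp (coordRestrict s)‖ ≤ ‖A‖ :=
  (A.opNorm_comp_le _).trans (mul_le_of_le_one_right (norm_nonneg _) (norm_coordRestrict_le s))

theorem norm_coordRestrict_comp_le (s : Set ℕ) (A : SeqLp 𝕜 p →L[𝕜] SeqLp 𝕜 p) :
    ‖(coordRestrict s).comp A‖ ≤ ‖A‖ :=
  (ContinuousLinearMap.opNorm_comp_le _ A).trans
    (mul_le_of_le_one_left (norm_nonneg _) (norm_coordRestrict_le s))

/-- If `A` attains its norm at `z` with `z n = 0`, then adding a small multiple of
`e_n* ⊗ A z` increases the norm: at `z + t e_n` the gain is linear in `t`, whereas `‖z + t e_n‖`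
is only `1 + O(t ^ p)`. The columns other than the `n`-th are not changed. -/
theorem exists_near_norm_comp_lt (hp : 1 < p.toReal) {N n : ℕ} (hn : n < N)
    {A : SeqLp 𝕜 p →L[𝕜] SeqLp 𝕜 p} (hA : A ∈ matrixSupported 𝕜 p (Set.Iio N)) (hA0 : A ≠ 0)
    {ε : ℝ} (hε : 0 < ε) :
    ∃ B ∈ matrixSupported 𝕜 p (Set.Iio N), ‖B - A‖ < ε ∧
      ‖B.comp (coordRestrict {n}ᶜ)‖ < ‖B‖ := by
  have hp0 : 0 < p.toReal := zero_lt_one.trans hp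
  rcases (norm_comp_coordRestrict_le {n}ᶜ A).lt_or_eq with hlt | heq
  · exact ⟨A, hA, by simpa using hε, hlt⟩
  have hApos : 0 < ‖A‖ := norm_pos_iff.2 hA0
  obtain ⟨x, hx1, -, hx⟩ := exists_norm_apply_eq N (A.comp (coordRestrict {n}ᶜ)) fun x => by
    rw [ContinuousLinearMap.comp_apply, ContinuousLinearMap.comp_apply, coordRestrict_comm, hA.1]
  rw [heq, ContinuousLinearMap.comp_apply] at hx
  set z := coordRestrict {n}ᶜ x with hz
  have hz1 : ‖z‖ ≤ 1 := (norm_coordRestrict_apply_le _ _).trans hx1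
  have hzn : z n = 0 := coordRestrict_apply_of_notMem (by simp) x
  have hzz : coordRestrict {n}ᶜ z = z := coordRestrict_idem _ _
  set e : SeqLp 𝕜 p := lp.single p n 1 with he
  have hen : e n = 1 := lp.single_apply_self (E := fun _ : ℕ => 𝕜) p n 1
  set φ := lp.evalCLM 𝕜 (fun _ : ℕ => 𝕜) p n with hφ
  obtain ⟨ψ, hψ1, hψ⟩ := exists_dual_vector'' 𝕜 (A z)
  rw [hx] at hψ
  set η : ℝ := ε / (2 * ‖A‖) with hη
  have hη0 : 0 < η := by positivity
  -- The phases `u` of the perturbation and `w` of `t` are chosen so that no cancellation occurs.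
  obtain ⟨u, hu, hun⟩ := exists_norm_eq_one_norm_add_mul (ψ (A e)) ((η * ‖A‖ : ℝ) : 𝕜)
  rw [RCLike.norm_ofReal, abs_of_pos (by positivity)] at hun
  set B := A + (u * (η : 𝕜)) • φ.smulRight (A z) with hB
  have hBQ : B.comp (coordRestrict {n}ᶜ) = A.comp (coordRestrict {n}ᶜ) := by
    ext1 v
    have : φ (coordRestrict {n}ᶜ v) = 0 := coordRestrict_apply_of_notMem (by simp) v
    simp [hB, this]
  refine ⟨B, add_mem_matrixSupported hA (smul_mem_matrixSupported _
    (smulRight_mem_matrixSupported (fun v => ?_) (hA.2 z))), ?_, ?_⟩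
  · exact coordRestrict_apply_of_mem (s := Set.Iio N) hn v
  · rw [hB, add_sub_cancel_left, norm_smul, norm_mul, hu, one_mul, RCLike.norm_ofReal,
      abs_of_pos hη0, ContinuousLinearMap.norm_smulRight_apply, hx]
    calc η * (‖φ‖ * ‖A‖) ≤ η * (1 * ‖A‖) := by gcongr; exact norm_evalCLM_le n
      _ = ε / 2 := by rw [hη]; field_simp
      _ < ε := half_lt_self hε
  · rw [hBQ, heq]
    by_contra! hBA
    obtain ⟨τ, hτ, hτη⟩ : ∃ τ : ℝ, 0 < τ ∧ τ ^ (p.toReal - 1) < η := by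
      have h := (Real.continuousAt_rpow_const 0 (p.toReal - 1) (Or.inr (by linarith))).tendsto
      rw [Real.zero_rpow (by linarith)] at h
      obtain ⟨τ, h1, h2⟩ := (((tendsto_nhdsWithin_of_tendsto_nhds (s := Set.Ioi 0)
        h).eventually_lt_const hη0).and self_mem_nhdsWithin).exists
      exact ⟨τ, h2, h1⟩
    obtain ⟨w, hw, hwn⟩ := exists_norm_eq_one_norm_add_mul (‖A‖ : 𝕜)
      ((τ : 𝕜) * (ψ (A e) + u * ((η * ‖A‖ : ℝ) : 𝕜)))
    rw [norm_mul, hun, RCLike.norm_ofReal, RCLike.norm_ofReal, abs_of_pos hApos, abs_of_pos hτ]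
      at hwn
    have hval : ψ (B (z + (w * (τ : 𝕜)) • e)) =
        (‖A‖ : 𝕜) + w * ((τ : 𝕜) * (ψ (A e) + u * ((η * ‖A‖ : ℝ) : 𝕜))) := by
      have h1 : φ z = 0 := hzn
      have h2 : φ e = 1 := hen
      simp only [hB, add_apply, smul_apply, ContinuousLinearMap.smulRight_apply, map_add, map_smul,
        h1, h2, hψ, smul_eq_mul, one_smul, zero_smul, map_zero]
      push_cast
      ring
    have hnorm : ‖z + (w * (τ : 𝕜)) • e‖ ≤ 1 + τ ^ p.toReal := by
      refine le_one_add_of_rpow_le hp.le (by positivity) ?_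
      rw [norm_rpow_add_of_coordRestrict hp0 hzz
        (by rw [map_smul, coordRestrict_single_of_notMem (by simp), smul_zero])]
      have : ‖(w * (τ : 𝕜)) • e‖ = τ := by
        rw [norm_smul, norm_mul, hw, RCLike.norm_ofReal, abs_of_pos hτ, he,
          lp.norm_single (zero_lt_one.trans_le Fact.out), norm_one, one_mul, mul_one]
      rw [this]
      gcongr
      exact Real.rpow_le_one (norm_nonneg _) hz1 hp0.le
    have hle : ‖A‖ + τ * (‖ψ (A e)‖ + η * ‖A‖) ≤ ‖A‖ * (1 + τ ^ p.toReal) := by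
      rw [← hwn, ← hval]
      calc ‖ψ (B (z + (w * (τ : 𝕜)) • e))‖ ≤ ‖B (z + (w * (τ : 𝕜)) • e)‖ :=
            norm_apply_le_of_norm_le_one hψ1 _
        _ ≤ ‖B‖ * ‖z + (w * (τ : 𝕜)) • e‖ := B.le_opNorm _
        _ ≤ ‖A‖ * (1 + τ ^ p.toReal) := by gcongr
    have h2 : τ ^ p.toReal = τ * τ ^ (p.toReal - 1) := by
      rw [Real.rpow_sub_one hτ.ne']; field_simp
    rw [h2] at hle
    have h3 : τ * ‖A‖ * τ ^ (p.toReal - 1) < τ * ‖A‖ * η := by gcongr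
    nlinarith [mul_nonneg hτ.le (norm_nonneg (ψ (A e)))]

/-- If `A` attains its norm at `x` with `A x n = 0`, then adding a small multiple of `f ⊗ e_n`,
where `f` norms `x`, increases the norm. The rows other than the `n`-th are not changed. -/
theorem exists_near_norm_coordRestrict_comp_lt (hp : 0 < p.toReal) {N n : ℕ} (hn : n < N)
    {A : SeqLp 𝕜 p →L[𝕜] SeqLp 𝕜 p} (hA : A ∈ matrixSupported 𝕜 p (Set.Iio N)) (hA0 : A ≠ 0)
    {ε : ℝ} (hε : 0 < ε) :
    ∃ B ∈ matrixSupported 𝕜 p (Set.Iio N), ‖B - A‖ < ε ∧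
      ‖(coordRestrict {n}ᶜ).comp B‖ < ‖B‖ := by
  rcases (norm_coordRestrict_comp_le {n}ᶜ A).lt_or_eq with hlt | heq
  · exact ⟨A, hA, by simpa using hε, hlt⟩
  have hApos : 0 < ‖A‖ := norm_pos_iff.2 hA0
  obtain ⟨x, hx1, hxN, hx⟩ := exists_norm_apply_eq N ((coordRestrict {n}ᶜ).comp A) fun x => by
    rw [ContinuousLinearMap.comp_apply, ContinuousLinearMap.comp_apply, hA.1]
  rw [heq, ContinuousLinearMap.comp_apply] at hx
  have hxpos : 0 < ‖x‖ := by
    rw [norm_pos_iff]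
    rintro rfl
    rw [map_zero, map_zero, norm_zero] at hx
    exact hApos.ne hx
  have hAxn : A x n = 0 := by
    have h1 := norm_rpow_eq_compl_singleton hp n (A x)
    have h2 : ‖A x‖ ^ p.toReal ≤ ‖A‖ ^ p.toReal :=
      Real.rpow_le_rpow (norm_nonneg _) (A.unit_le_opNorm x hx1) hp.le
    rw [hx] at h1
    by_contra h0
    have := Real.rpow_pos_of_pos (norm_pos_iff.2 h0) p.toReal
    linarith
  obtain ⟨f, hf1, hf⟩ := exists_dual_vector'' 𝕜 x
  set f' : StrongDual 𝕜 (SeqLp 𝕜 p) := f.comp (coordRestrict (Set.Iio N)) with hf'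
  have hf'1 : ‖f'‖ ≤ 1 :=
    (f.opNorm_comp_le _).trans (mul_le_one₀ hf1 (norm_nonneg _) (norm_coordRestrict_le _))
  have hf'x : f' x = ‖x‖ := by rw [hf', ContinuousLinearMap.comp_apply, hxN, hf]
  set e : SeqLp 𝕜 p := lp.single p n 1 with he
  have hen : e n = 1 := lp.single_apply_self (E := fun _ : ℕ => 𝕜) p n 1
  have he1 : ‖e‖ = 1 := by
    rw [he, lp.norm_single (zero_lt_one.trans_le Fact.out), norm_one]
  have hQe : coordRestrict {n}ᶜ e = 0 := coordRestrict_single_of_notMem (by simp) _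
  set B := A + ((ε / 2 : ℝ) : 𝕜) • f'.smulRight e with hB
  have hQB : (coordRestrict {n}ᶜ).comp B = (coordRestrict {n}ᶜ).comp A := by
    ext1 v
    simp [hB, hQe]
  refine ⟨B, add_mem_matrixSupported hA (smul_mem_matrixSupported _
    (smulRight_mem_matrixSupported (fun v => ?_) ?_)), ?_, ?_⟩
  · rw [hf', ContinuousLinearMap.comp_apply, coordRestrict_idem, ContinuousLinearMap.comp_apply]
  · exact coordRestrict_single_of_mem (s := Set.Iio N) hn 1
  · rw [hB, add_sub_cancel_left, norm_smul, RCLike.norm_ofReal, abs_of_pos (by positivity),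
      ContinuousLinearMap.norm_smulRight_apply, he1, mul_one]
    calc ε / 2 * ‖f'‖ ≤ ε / 2 * 1 := by gcongr
      _ < ε := by linarith
  · rw [hQB, heq]
    refine lt_of_lt_of_le ?_ (B.unit_le_opNorm x hx1)
    rw [← Real.rpow_lt_rpow_iff (norm_nonneg _) (norm_nonneg _) hp,
      norm_rpow_eq_compl_singleton hp n (B x), ← ContinuousLinearMap.comp_apply, hQB,
      ContinuousLinearMap.comp_apply, hx]
    have hBxn : B x n = ((ε / 2 * ‖x‖ : ℝ) : 𝕜) := by
      rw [hB, add_apply, lp.coeFn_add, Pi.add_apply, hAxn, smul_apply,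
        ContinuousLinearMap.smulRight_apply, hf'x, lp.coeFn_smul, Pi.smul_apply, lp.coeFn_smul,
        Pi.smul_apply, hen]
      simp
    have : 0 < ‖B x n‖ := by
      rw [hBxn, RCLike.norm_ofReal]
      positivity
    linarith [Real.rpow_pos_of_pos this p.toReal]

/-- Finitely many open conditions `g n A < ‖A‖`, each of which can be reached by arbitrarily small
perturbations, can be reached simultaneously. -/
theorem exists_near_forall_lt_norm {E : Type*} [NormedAddCommGroup E] {V : Set E} {g : ℕ → E → ℝ}
    (hg : ∀ n, Continuous (g n)) (hg0 : ∀ n A, 0 ≤ g n A) {N : ℕ}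
    (hstep : ∀ n < N, ∀ A ∈ V, A ≠ 0 → ∀ ε > 0, ∃ B ∈ V, ‖B - A‖ < ε ∧ g n B < ‖B‖)
    {A : E} (hA : A ∈ V) (hA0 : A ≠ 0) {ε : ℝ} (hε : 0 < ε) :
    ∃ B ∈ V, B ≠ 0 ∧ ‖B - A‖ < ε ∧ ∀ n < N, g n B < ‖B‖ := by
  induction N with
  | zero => exact ⟨A, hA, hA0, by simpa using hε, by simp⟩
  | succ N ih =>
    obtain ⟨B, hBV, hB0, hBA, hB⟩ := ih fun n hn => hstep n (hn.trans (Nat.lt_succ_self N))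
    have hopen : IsOpen {C : E | ‖C - A‖ < ε ∧ ∀ n ∈ Finset.range N, g n C < ‖C‖} := by
      have : {C : E | ‖C - A‖ < ε ∧ ∀ n ∈ Finset.range N, g n C < ‖C‖} =
          {C | ‖C - A‖ < ε} ∩ ⋂ n ∈ Finset.range N, {C | g n C < ‖C‖} := by
        ext C
        simp
      rw [this]
      exact (isOpen_lt (continuous_id.sub continuous_const).norm continuous_const).inter
        (isOpen_biInter_finset fun n _ => isOpen_lt (hg n) continuous_norm)
    obtain ⟨δ, hδ, hball⟩ := Metric.isOpen_iff.1 hopen B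
      ⟨hBA, fun n hn => hB n (Finset.mem_range.1 hn)⟩
    obtain ⟨C, hCV, hCB, hC⟩ := hstep N (Nat.lt_succ_self N) B hBV hB0 δ hδ
    obtain ⟨hCA, hC'⟩ := hball (show C ∈ Metric.ball B δ by rwa [mem_ball_iff_norm])
    refine ⟨C, hCV, norm_pos_iff.1 ((hg0 N C).trans_lt hC), hCA, fun n hn => ?_⟩
    rcases Nat.lt_succ_iff_lt_or_eq.1 hn with h | rfl
    · exact hC' n (Finset.mem_range.2 h)
    · exact hC

theorem add_coordRestrict_compl_apply {s : Set ℕ} (A : SeqLp 𝕜 p →L[𝕜] SeqLp 𝕜 p) {x : SeqLp 𝕜 p}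
    (hx : coordRestrict s x = x) : (A + coordRestrict sᶜ : SeqLp 𝕜 p →L[𝕜] SeqLp 𝕜 p) x = A x := by
  rw [add_apply, coordRestrict_eq_zero_of_disjoint disjoint_compl_left hx, add_zero]

theorem add_coordRestrict_compl_single {s : Set ℕ} {A : SeqLp 𝕜 p →L[𝕜] SeqLp 𝕜 p}
    (hA : A ∈ matrixSupported 𝕜 p s) {n : ℕ} (hn : n ∉ s) :
    (A + coordRestrict sᶜ : SeqLp 𝕜 p →L[𝕜] SeqLp 𝕜 p) (lp.single p n 1) = lp.single p n 1 := by
  rw [add_apply, ← hA.1, coordRestrict_single_of_notMem hn, map_zero, zero_add,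
    coordRestrict_single_of_mem hn]

/-- A vector at which `A` attains its norm has a nonzero `n`-th coordinate, because deleting the
`n`-th column decreases the norm. -/
theorem normsInputs_add_coordRestrict {N : ℕ} {A : SeqLp 𝕜 p →L[𝕜] SeqLp 𝕜 p}
    (hA : A ∈ matrixSupported 𝕜 p (Set.Iio N)) (hA1 : ‖A‖ = 1)
    (h : ∀ n < N, ‖A.comp (coordRestrict {n}ᶜ)‖ < ‖A‖) :
    NormsInputs (A + coordRestrict (Set.Iio N)ᶜ) := by
  refine ⟨fun n => ?_⟩
  rcases lt_or_ge n N with hn | hn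
  · obtain ⟨x, hx1, hxN, hx⟩ := exists_norm_apply_eq N A hA.1
    refine ⟨x, N, ?_, fun hxn => ?_, ?_, ?_⟩
    · rw [add_coordRestrict_compl_apply A hxN]
      exact le_antisymm (norm_apply_le_of_norm_le_one hA1.le x) (by rw [hx, hA1]; exact hx1)
    · have hQ : coordRestrict {n}ᶜ x = x := coordRestrict_eq_self_iff.2 fun k hk => by
        rw [Set.notMem_compl_iff, Set.mem_singleton_iff] at hk
        rwa [hk]
      have := (A.comp (coordRestrict {n}ᶜ)).unit_le_opNorm x hx1
      rw [ContinuousLinearMap.comp_apply, hQ, hx] at this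
      exact absurd (h n hn) (not_lt.2 this)
    · rw [add_coordRestrict_compl_apply A hxN, hA.2]
    · rw [add_coordRestrict_compl_apply A (coordRestrict_single_of_mem (s := Set.Iio N) hn 1), hA.2]
  · have he := add_coordRestrict_compl_single hA (n := n) (by simpa using hn)
    have hK : coordRestrict (Set.Iio (n + 1)) (lp.single p n 1 : SeqLp 𝕜 p) = lp.single p n 1 :=
      coordRestrict_single_of_mem (by simp) 1
    exact ⟨lp.single p n 1, n + 1, by rw [he], by simp, by rw [he, hK], by rw [he, hK]⟩

/-- A vector at which `A` attains its norm has an image with a nonzero `n`-th coordinate, because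
deleting the `n`-th row decreases the norm. -/
theorem normsOutputs_add_coordRestrict {N : ℕ} {A : SeqLp 𝕜 p →L[𝕜] SeqLp 𝕜 p}
    (hA : A ∈ matrixSupported 𝕜 p (Set.Iio N)) (hA1 : ‖A‖ = 1)
    (h : ∀ n < N, ‖(coordRestrict {n}ᶜ).comp A‖ < ‖A‖) :
    NormsOutputs (A + coordRestrict (Set.Iio N)ᶜ) := by
  refine ⟨fun n => ?_⟩
  rcases lt_or_ge n N with hn | hn
  · obtain ⟨x, hx1, hxN, hx⟩ := exists_norm_apply_eq N A hA.1
    refine ⟨x, N, ?_, fun hxn => ?_, hxN, ?_⟩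
    · rw [add_coordRestrict_compl_apply A hxN]
      exact le_antisymm (norm_apply_le_of_norm_le_one hA1.le x) (by rw [hx, hA1]; exact hx1)
    · rw [add_coordRestrict_compl_apply A hxN] at hxn
      have hQ : coordRestrict {n}ᶜ (A x) = A x := coordRestrict_eq_self_iff.2 fun k hk => by
        rw [Set.notMem_compl_iff, Set.mem_singleton_iff] at hk
        rwa [hk]
      have := ((coordRestrict {n}ᶜ).comp A).unit_le_opNorm x hx1
      rw [ContinuousLinearMap.comp_apply, hQ, hx] at this
      exact absurd (h n hn) (not_lt.2 this)
    · rw [add_coordRestrict_compl_apply A hxN, hA.2]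
  · have he := add_coordRestrict_compl_single hA (n := n) (by simpa using hn)
    have hK : coordRestrict (Set.Iio (n + 1)) (lp.single p n 1 : SeqLp 𝕜 p) = lp.single p n 1 :=
      coordRestrict_single_of_mem (by simp) 1
    exact ⟨lp.single p n 1, n + 1, by rw [he], by rw [he]; simp, hK, by rw [he, hK]⟩

/-- The compression of `T` to the first `N` coordinates, completed by the identity on the other
coordinates. -/
noncomputable def truncation (N : ℕ) (T : SeqLp 𝕜 p →L[𝕜] SeqLp 𝕜 p) :
    SeqLp 𝕜 p →L[𝕜] SeqLp 𝕜 p :=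
  (coordRestrict (Set.Iio N)).comp (T.comp (coordRestrict (Set.Iio N))) +
    coordRestrict (Set.Iio N)ᶜ

/-- The truncations of a contraction are approximated in norm by direct sums of a matrix of norm
one satisfying the conditions `g n A < ‖A‖` and of the identity. Keeping one coordinate of the
identity inside the matrix makes its norm exactly one, so that normalizing a perturbation of it is
itself a small perturbation. -/
theorem exists_near_truncation (hp : 0 < p.toReal) {T : SeqLp 𝕜 p →L[𝕜] SeqLp 𝕜 p} (hT : ‖T‖ ≤ 1)
    {g : ℕ → (SeqLp 𝕜 p →L[𝕜] SeqLp 𝕜 p) → ℝ} (hg : ∀ n, Continuous (g n))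
    (hg0 : ∀ n A, 0 ≤ g n A) (hgsmul : ∀ n (c : 𝕜) A, g n (c • A) = ‖c‖ * g n A)
    (hstep : ∀ {N n : ℕ}, n < N → ∀ {A}, A ∈ matrixSupported 𝕜 p (Set.Iio N) → A ≠ 0 →
      ∀ {ε : ℝ}, 0 < ε → ∃ B ∈ matrixSupported 𝕜 p (Set.Iio N), ‖B - A‖ < ε ∧ g n B < ‖B‖)
    (N : ℕ) {ε : ℝ} (hε : 0 < ε) :
    ∃ M, ∃ A ∈ matrixSupported 𝕜 p (Set.Iio M), ‖A‖ = 1 ∧ (∀ n < M, g n A < ‖A‖) ∧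
      ‖A + coordRestrict (Set.Iio M)ᶜ - truncation N T‖ < ε := by
  set P : SeqLp 𝕜 p →L[𝕜] SeqLp 𝕜 p := coordRestrict (Set.Iio N) with hP
  set C := P.comp (T.comp P) with hC
  have hCN : C ∈ matrixSupported 𝕜 p (Set.Iio N) :=
    ⟨fun x => by simp only [hC, hP, ContinuousLinearMap.comp_apply, coordRestrict_idem],
      fun x => by simp only [hC, hP, ContinuousLinearMap.comp_apply, coordRestrict_idem]⟩
  have hC1 : ‖C‖ ≤ 1 :=
    (norm_coordRestrict_comp_le _ _).trans ((norm_comp_coordRestrict_le _ _).trans hT)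
  have hsub : Set.Iio N ⊆ Set.Iio (N + 1) := Set.Iio_subset_Iio (Nat.le_succ N)
  set A₀ := C + coordRestrict {N} with hA₀
  have hA₀M : A₀ ∈ matrixSupported 𝕜 p (Set.Iio (N + 1)) := by
    refine add_mem_matrixSupported ⟨fun x => ?_, fun x => coordRestrict_mono hsub (hCN.2 x)⟩
      ⟨fun x => ?_, fun x => ?_⟩
    · rw [← hCN.1, coordRestrict_coordRestrict, Set.inter_eq_left.2 hsub, hCN.1]
    · rw [coordRestrict_coordRestrict, Set.inter_eq_left.2 (by simp)]
    · rw [coordRestrict_coordRestrict, Set.inter_eq_right.2 (by simp)]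
  have hA₀1 : ‖A₀‖ = 1 := by
    refine le_antisymm (norm_add_coordRestrict_le_one hp (by simp) hCN hC1) ?_
    have he : A₀ (lp.single p N 1) = lp.single p N 1 := by
      rw [hA₀, add_apply, ← hCN.1, coordRestrict_single_of_notMem (by simp), map_zero, zero_add,
        coordRestrict_single_of_mem (by simp)]
    have he1 : ‖(lp.single p N 1 : SeqLp 𝕜 p)‖ = 1 := by
      rw [lp.norm_single (zero_lt_one.trans_le Fact.out), norm_one]
    have := A₀.unit_le_opNorm _ he1.le
    rwa [he, he1] at this
  have hA₀0 : A₀ ≠ 0 := norm_ne_zero_iff.1 (by rw [hA₀1]; exact one_ne_zero)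
  obtain ⟨B, hBM, hB0, hBA, hB⟩ := exists_near_forall_lt_norm hg hg0
    (V := matrixSupported 𝕜 p (Set.Iio (N + 1))) (N := N + 1)
    (fun n hn A hA hA0 δ hδ => hstep hn hA hA0 hδ) hA₀M hA₀0 (half_pos hε)
  have hBpos : 0 < ‖B‖ := norm_pos_iff.2 hB0
  have hcB : ‖((‖B‖⁻¹ : ℝ) : 𝕜)‖ = ‖B‖⁻¹ := by
    rw [RCLike.norm_ofReal, abs_of_pos (inv_pos.2 hBpos)]
  have hnorm : ‖((‖B‖⁻¹ : ℝ) : 𝕜) • B‖ = 1 := by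
    rw [norm_smul, hcB, inv_mul_cancel₀ hBpos.ne']
  refine ⟨N + 1, ((‖B‖⁻¹ : ℝ) : 𝕜) • B, smul_mem_matrixSupported _ hBM, hnorm, fun n hn => ?_, ?_⟩
  · rw [hgsmul, norm_smul, hcB]
    exact mul_lt_mul_of_pos_left (hB n hn) (inv_pos.2 hBpos)
  · have hid : (coordRestrict (Set.Iio N)ᶜ : SeqLp 𝕜 p →L[𝕜] SeqLp 𝕜 p) =
        coordRestrict {N} + coordRestrict (Set.Iio (N + 1))ᶜ := by
      ext1 x
      refine lp.ext (funext fun k => ?_)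
      rw [add_apply, lp.coeFn_add, Pi.add_apply]
      simp only [coordRestrict_apply, Set.indicator_apply, Set.mem_compl_iff, Set.mem_Iio,
        Set.mem_singleton_iff]
      split_ifs <;> first | omega | simp
    have heq : ((‖B‖⁻¹ : ℝ) : 𝕜) • B + coordRestrict (Set.Iio (N + 1))ᶜ - truncation N T =
        (((‖B‖⁻¹ : ℝ) : 𝕜) • B - B) + (B - A₀) := by
      rw [truncation, hid, hA₀]
      abel
    have hdiff : ‖((‖B‖⁻¹ : ℝ) : 𝕜) • B - B‖ ≤ ‖B - A₀‖ := by
      have h1 : ((‖B‖⁻¹ : ℝ) : 𝕜) • B - B = ((‖B‖⁻¹ - 1 : ℝ) : 𝕜) • B := by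
        push_cast
        rw [sub_smul, one_smul]
      rw [h1, norm_smul, RCLike.norm_ofReal, ← abs_of_pos hBpos, ← abs_mul, abs_of_pos hBpos,
        sub_mul, one_mul, inv_mul_cancel₀ hBpos.ne', abs_sub_comm, ← hA₀1]
      exact abs_norm_sub_norm_le B A₀
    rw [heq]
    linarith [norm_add_le (((‖B‖⁻¹ : ℝ) : 𝕜) • B - B) (B - A₀)]

/-- Contractions converging strongly to the identity at `x` may be applied to vectors tending
to `x`. -/
theorem tendsto_apply_of_strong {E ι : Type*} [NormedAddCommGroup E] [NormedSpace 𝕜 E]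
    {l : Filter ι} {F : ι → E →L[𝕜] E} (hF : ∀ i, ‖F i‖ ≤ 1) {w : ι → E} {x : E}
    (hFx : Tendsto (fun i => F i x) l (𝓝 x)) (hw : Tendsto w l (𝓝 x)) :
    Tendsto (fun i => F i (w i)) l (𝓝 x) := by
  have h1 : Tendsto (fun i => F i (w i - x)) l (𝓝 0) :=
    squeeze_zero_norm (fun i => norm_apply_le_of_norm_le_one (hF i) _)
      (tendsto_iff_norm_sub_tendsto_zero.1 hw)
  simpa using h1.add hFx

theorem tendsto_truncation_apply (hp_top : p ≠ ⊤) (T : SeqLp 𝕜 p →L[𝕜] SeqLp 𝕜 p)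
    (x : SeqLp 𝕜 p) : Tendsto (fun N => truncation N T x) atTop (𝓝 (T x)) := by
  have h1 : Tendsto (fun N => coordRestrict (Set.Iio N) (T (coordRestrict (Set.Iio N) x))) atTop
      (𝓝 (T x)) :=
    tendsto_apply_of_strong (fun _ => norm_coordRestrict_le _)
      (tendsto_coordRestrict_Iio hp_top _)
      ((T.continuous.tendsto _).comp (tendsto_coordRestrict_Iio hp_top x))
  have h2 : Tendsto (fun N => coordRestrict (Set.Iio N)ᶜ x) atTop (𝓝 0) := by
    have := (tendsto_coordRestrict_Iio hp_top x).const_sub x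
    rw [sub_self] at this
    exact this.congr fun N => sub_eq_of_eq_add' (coordRestrict_add_compl _ x).symm
  simpa [truncation] using h1.add h2

theorem tendsto_comp_truncation (hp1 : 1 < p.toReal) (hp_top : p ≠ ⊤)
    (T : SeqLp 𝕜 p →L[𝕜] SeqLp 𝕜 p) (f : StrongDual 𝕜 (SeqLp 𝕜 p)) :
    Tendsto (fun N => f.comp (truncation N T)) atTop (𝓝 (f.comp T)) := by
  have h0 : Tendsto (fun N => (f.comp (coordRestrict (Set.Iio N))).comp T) atTop
      (𝓝 (f.comp T)) :=
    (((ContinuousLinearMap.precomp 𝕜 T).continuous.tendsto f)).comp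
      (tendsto_comp_coordRestrict_Iio hp1 hp_top f)
  have h1 : Tendsto (fun N => ((f.comp (coordRestrict (Set.Iio N))).comp T).comp
      (coordRestrict (Set.Iio N))) atTop (𝓝 (f.comp T)) := by
    refine tendsto_apply_of_strong (𝕜 := 𝕜)
      (F := fun N => ContinuousLinearMap.precomp 𝕜 (coordRestrict (Set.Iio N))) (fun N => ?_)
      (tendsto_comp_coordRestrict_Iio hp1 hp_top (f.comp T)) h0
    refine ContinuousLinearMap.opNorm_le_bound _ zero_le_one fun g => ?_
    rw [one_mul]
    exact (g.opNorm_comp_le _).trans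
      (mul_le_of_le_one_right (norm_nonneg _) (norm_coordRestrict_le _))
  have h2 : Tendsto (fun N => f.comp (coordRestrict (Set.Iio N)ᶜ)) atTop (𝓝 0) :=
    tendsto_zero_iff_norm_tendsto_zero.2 (tendsto_norm_comp_coordRestrict_compl hp1 hp_top f)
  have h3 := h1.add h2
  rw [add_zero] at h3
  refine h3.congr fun N => ?_
  rw [truncation, ContinuousLinearMap.comp_add]
  rfl

/-- A set of contractions approximating in norm all truncations of contractions is dense for the
strong* operator topology. -/
theorem dense_SOTStar_of_near_truncation (hp1 : 1 < p.toReal) (hp_top : p ≠ ⊤)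
    {D : Set (OpBall 𝕜 (SeqLp 𝕜 p))}
    (hD : ∀ (T : OpBall 𝕜 (SeqLp 𝕜 p)) (N : ℕ) (ε : ℝ), 0 < ε →
      ∃ G ∈ D, ‖G.1 - truncation N T.1‖ < ε) :
    @Dense _ (OpTopology.SOTStar 𝕜 (SeqLp 𝕜 p)) D := by
  intro T
  choose G hGD hG using fun N : ℕ => hD T N (1 / ((N : ℝ) + 1)) (by positivity)
  have hG0 : Tendsto (fun N => (G N).1 - truncation N T.1) atTop (𝓝 0) :=
    squeeze_zero_norm (fun N => (hG N).le) tendsto_one_div_add_atTop_nhds_zero_nat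
  refine @mem_closure_of_tendsto _ (OpTopology.SOTStar 𝕜 (SeqLp 𝕜 p)) _ T D G atTop _
    (tendsto_nhds_SOTStar.2 ⟨tendsto_nhds_SOT.2 fun x => ?_,
      tendsto_nhds_SOTLowerStar.2 fun f => ?_⟩) (Eventually.of_forall hGD)
  · have h1 : Tendsto (fun N => ((G N).1 - truncation N T.1) x) atTop (𝓝 0) := by
      have := ((ContinuousLinearMap.apply 𝕜 (SeqLp 𝕜 p) x).continuous.tendsto 0).comp hG0
      rwa [map_zero] at this
    have := h1.add (tendsto_truncation_apply hp_top T.1 x)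
    simpa using this
  · have h1 : Tendsto (fun N => f.comp ((G N).1 - truncation N T.1)) atTop (𝓝 0) := by
      have := ((f.postcomp (SeqLp 𝕜 p)).continuous.tendsto 0).comp hG0
      rwa [map_zero] at this
    have := h1.add (tendsto_comp_truncation hp1 hp_top T.1 f)
    rw [zero_add] at this
    refine this.congr fun N => ?_
    rw [← ContinuousLinearMap.comp_add, sub_add_cancel]

theorem dense_normsInputs (hp1 : 1 < p.toReal) (hp_top : p ≠ ⊤) :
    @Dense _ (OpTopology.SOTStar 𝕜 (SeqLp 𝕜 p))
      {T : OpBall 𝕜 (SeqLp 𝕜 p) | NormsInputs T.1} := by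
  have hp0 : 0 < p.toReal := zero_lt_one.trans hp1
  refine dense_SOTStar_of_near_truncation hp1 hp_top fun T N ε hε => ?_
  obtain ⟨M, A, hA, hA1, hgA, hnear⟩ := exists_near_truncation hp0 T.2
    (g := fun n A => ‖A.comp (coordRestrict {n}ᶜ)‖)
    (fun n => (ContinuousLinearMap.precomp (SeqLp 𝕜 p)
      (coordRestrict {n}ᶜ : SeqLp 𝕜 p →L[𝕜] SeqLp 𝕜 p)).continuous.norm)
    (fun n A => norm_nonneg _)
    (fun n c A => by rw [ContinuousLinearMap.smul_comp, norm_smul])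
    (exists_near_norm_comp_lt hp1) N hε
  exact ⟨⟨A + coordRestrict (Set.Iio M)ᶜ,
    norm_add_coordRestrict_le_one hp0 disjoint_compl_right hA hA1.le⟩,
    normsInputs_add_coordRestrict hA hA1 hgA, hnear⟩

theorem dense_normsOutputs (hp1 : 1 < p.toReal) (hp_top : p ≠ ⊤) :
    @Dense _ (OpTopology.SOTStar 𝕜 (SeqLp 𝕜 p))
      {T : OpBall 𝕜 (SeqLp 𝕜 p) | NormsOutputs T.1} := by
  have hp0 : 0 < p.toReal := zero_lt_one.trans hp1
  refine dense_SOTStar_of_near_truncation hp1 hp_top fun T N ε hε => ?_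
  obtain ⟨M, A, hA, hA1, hgA, hnear⟩ := exists_near_truncation hp0 T.2
    (g := fun n A => ‖(coordRestrict {n}ᶜ : SeqLp 𝕜 p →L[𝕜] SeqLp 𝕜 p).comp A‖)
    (fun n => (ContinuousLinearMap.postcomp (SeqLp 𝕜 p)
      (coordRestrict {n}ᶜ : SeqLp 𝕜 p →L[𝕜] SeqLp 𝕜 p)).continuous.norm)
    (fun n A => norm_nonneg _)
    (fun n c A => by rw [ContinuousLinearMap.comp_smul, norm_smul])
    (exists_near_norm_coordRestrict_comp_lt hp0) N hε
  exact ⟨⟨A + coordRestrict (Set.Iio M)ᶜ,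
    norm_add_coordRestrict_le_one hp0 disjoint_compl_right hA hA1.le⟩,
    normsOutputs_add_coordRestrict hA hA1 hgA, hnear⟩

end Density

/-! ### Similarity of the operator topologies -/

theorem theoremA (𝕜 : Type*) [RCLike 𝕜] (p : ℝ≥0∞) [Fact (1 ≤ p)]
    (hp : 1 < p) (hp_top : p ≠ ⊤) :
    (2 < p →
      SimilarTopologies (OpTopology.SOT 𝕜 (SeqLp 𝕜 p)) (OpTopology.SOTStar 𝕜 (SeqLp 𝕜 p)) ∧
      SimilarTopologies (OpTopology.WOT 𝕜 (SeqLp 𝕜 p)) (OpTopology.SOTLowerStar 𝕜 (SeqLp 𝕜 p)) ∧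
      @Dense _ (OpTopology.SOTStar 𝕜 (SeqLp 𝕜 p))
        (continuityPoints (OpTopology.WOT 𝕜 (SeqLp 𝕜 p))
          (OpTopology.SOTLowerStar 𝕜 (SeqLp 𝕜 p))) ∧
      @Dense _ (OpTopology.SOTStar 𝕜 (SeqLp 𝕜 p))
        (continuityPoints (OpTopology.SOT 𝕜 (SeqLp 𝕜 p))
          (OpTopology.SOTStar 𝕜 (SeqLp 𝕜 p)))) ∧
    (p < 2 →
      SimilarTopologies (OpTopology.SOTLowerStar 𝕜 (SeqLp 𝕜 p)) (OpTopology.SOTStar 𝕜 (SeqLp 𝕜 p)) ∧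
      SimilarTopologies (OpTopology.WOT 𝕜 (SeqLp 𝕜 p)) (OpTopology.SOT 𝕜 (SeqLp 𝕜 p)) ∧
      @Dense _ (OpTopology.SOTStar 𝕜 (SeqLp 𝕜 p))
        (continuityPoints (OpTopology.WOT 𝕜 (SeqLp 𝕜 p))
          (OpTopology.SOT 𝕜 (SeqLp 𝕜 p))) ∧
      @Dense _ (OpTopology.SOTStar 𝕜 (SeqLp 𝕜 p))
        (continuityPoints (OpTopology.SOTLowerStar 𝕜 (SeqLp 𝕜 p))
          (OpTopology.SOTStar 𝕜 (SeqLp 𝕜 p))))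
 := by
  have hp1 : 1 < p.toReal := by
    simpa using (ENNReal.toReal_lt_toReal ENNReal.one_ne_top hp_top).2 hp
  refine ⟨fun h2 => ?_, fun h2 => ?_⟩
  · have hd : @Dense _ (OpTopology.SOTStar 𝕜 (SeqLp 𝕜 p))
        (continuityPoints (OpTopology.WOT 𝕜 (SeqLp 𝕜 p))
          (OpTopology.SOTLowerStar 𝕜 (SeqLp 𝕜 p))) :=
      @Dense.mono _ (OpTopology.SOTStar 𝕜 (SeqLp 𝕜 p)) _ _
        (fun T hT => NormsOutputs.mem_continuityPoints h2 hp_top hT)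
        (dense_normsOutputs hp1 hp_top)
    have hd' : @Dense _ (OpTopology.SOTStar 𝕜 (SeqLp 𝕜 p))
        (continuityPoints (OpTopology.SOT 𝕜 (SeqLp 𝕜 p))
          (OpTopology.SOTStar 𝕜 (SeqLp 𝕜 p))) := by
      refine @Dense.mono _ (OpTopology.SOTStar 𝕜 (SeqLp 𝕜 p)) _ _ ?_ hd
      have := continuityPoints_subset_inf (τ' := OpTopology.SOTLowerStar 𝕜 (SeqLp 𝕜 p))
        (SOT_le_WOT (𝕜 := 𝕜) (X := SeqLp 𝕜 p))
      rwa [← SOTStar_eq_inf] at this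
    exact ⟨.of_dense_continuityPoints SOTStar_le_SOT hd',
      .of_dense_continuityPoints SOTLowerStar_le_WOT (hd.of_le SOTStar_le_SOTLowerStar), hd, hd'⟩
  · have hd : @Dense _ (OpTopology.SOTStar 𝕜 (SeqLp 𝕜 p))
        (continuityPoints (OpTopology.WOT 𝕜 (SeqLp 𝕜 p)) (OpTopology.SOT 𝕜 (SeqLp 𝕜 p))) :=
      @Dense.mono _ (OpTopology.SOTStar 𝕜 (SeqLp 𝕜 p)) _ _
        (fun T hT => NormsInputs.mem_continuityPoints h2 hT)
        (dense_normsInputs hp1 hp_top)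
    have hd' : @Dense _ (OpTopology.SOTStar 𝕜 (SeqLp 𝕜 p))
        (continuityPoints (OpTopology.SOTLowerStar 𝕜 (SeqLp 𝕜 p))
          (OpTopology.SOTStar 𝕜 (SeqLp 𝕜 p))) := by
      refine @Dense.mono _ (OpTopology.SOTStar 𝕜 (SeqLp 𝕜 p)) _ _ ?_ hd
      have := continuityPoints_subset_inf (τ' := OpTopology.SOT 𝕜 (SeqLp 𝕜 p))
        (SOTLowerStar_le_WOT (𝕜 := 𝕜) (X := SeqLp 𝕜 p))
      rwa [inf_comm, ← SOTStar_eq_inf] at this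
    exact ⟨.of_dense_continuityPoints SOTStar_le_SOTLowerStar hd',
      .of_dense_continuityPoints SOT_le_WOT (hd.of_le SOTStar_le_SOT), hd, hd'⟩
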